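/- Let $X$ and $Y$ be Polish spaces with non-atomic, infinite, $\sigma$-finite Borel measures $\mu$ and $\nu$ respectively. Suppose that each of $X$ and $Y$ has at least one open subset of finite non-zero measure. Let $T: X \to X$ and $S: Y \to Y$ be ergodic measure-preserving homeomorphisms of $(X,\mu)$ and $(Y,\nu)$. Then there are $G_\delta$ subsets $X' \subset X$ and $Y' \subset Y$ with $T^{-1}X' = X'$, $S^{-1}Y' = Y'$, $\mu(X\setminus X') = 0$ and $\nu(Y \setminus Y') = 0$, and a homeomorphism $\varphi : X' \to Y'$ which maps $\mu|_{X'}$ to $\nu|_{Y'}$ and maps $T$-orbits onto $S$-orbits, that is, $\varphi(\{T^n x : n \in \mathbb{Z}\}) = \{S^n \varphi(x) : n \in \mathbb{Z}\}$ for every $x \in X'$. -/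

import Mathlib

open Set MeasureTheory

universe u v

/-- The full (two-sided) orbit `{Tⁿ x : n ∈ ℤ}` of a point under a homeomorphism. Powers are taken
in the group of self-homeomorphisms, so `T ^ (-1)` is the inverse of `T`. -/
def zorbit {X : Type u} [TopologicalSpace X] (T : X ≃ₜ X) (x : X) : Set X :=
  Set.range fun n : ℤ => (T ^ n) x

/-- `(X, μ, T)` and `(Y, ν, S)` are orbit equivalent through a measure-preserving homeomorphism
`φ : X' ≃ₜ Y'` between invariant `G_δ` subsets `X'`, `Y'` of full measure. The measures on `X'`
and `Y'` are the restrictions of `μ` and `ν`, and `φ` maps the `T`-orbit of each point of `X'`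
onto the whole `S`-orbit of its image. -/
def AlmostContinuouslyOrbitEquivalent {X : Type u} {Y : Type v}
    [TopologicalSpace X] [MeasurableSpace X] [TopologicalSpace Y] [MeasurableSpace Y]
    (μ : Measure X) (ν : Measure Y) (T : X ≃ₜ X) (S : Y ≃ₜ Y) : Prop :=
  ∃ (X' : Set X) (Y' : Set Y),
    IsGδ X' ∧ IsGδ Y' ∧
    T ⁻¹' X' = X' ∧ S ⁻¹' Y' = Y' ∧
    μ X'ᶜ = 0 ∧ ν Y'ᶜ = 0 ∧
    ∃ φ : X' ≃ₜ Y',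
      MeasurePreserving φ (μ.comap Subtype.val) (ν.comap Subtype.val) ∧
      ∀ x : X', (fun z : X' => (φ z : Y)) '' {z : X' | (z : X) ∈ zorbit T x} = zorbit S (φ x)

/-!
Both systems are coded by the same standard model: sequences of natural numbers, of which the first
runs over infinitely many values and each later one over finitely many, with two sequences being
equivalent when they have the same tail. Under the codings, orbits become tail equivalence classes
and all cylinders of the same length have the same measure. Points of `X` and `Y` with the same
code then correspond to each other.

The coding is built from finite approximations of the orbit relation. A *stage* (`IsStage`) divides
`X` into pieces of equal finite measure, indexed by finite words, which are identified with each
other along orbits by maps that are locally powers of `T`. One stage is refined to the next by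
dividing its base into finitely many pieces of equal measure (`IsStage.exists_refines`), and the
coding map reads off the successive digits. For it to be injective and to carry orbits onto tail
classes, the refinement (`IsCoordinate.exists_isArray`) has to separate points by given open sets,
and to absorb a given finite set of orbit connections, up to small measure. To this end orbits are
divided into blocks between the visits to a very small set. Most points are far from the ends of
their block, so that the given connections stay within the block. The blocks are sorted into columns
according to the positions of their points, and the columns are cut into pieces of equal small
measure, which are linked by the Hopf equivalence of sets of equal measure
(`exists_hopf_equivalence`).

Any sufficiently large number of pieces can be used in a refinement, so the same numbers can be used
for `T` and for `S` (`exists_parallel_stages`); this makes the two models equal.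

All sets in the construction have null boundary, and all maps are locally powers of `T`, outside a
null set. Therefore everything is continuous on an invariant `G_δ` set of full measure (`IsCore`).
That a point is good at infinitely many stages is again a `G_δ` condition of full measure, and
it suffices for the coding to be an embedding on this set (`exists_isCoding`). The range of an
embedding of a `G_δ` set is a `G_δ` (`Topology.IsEmbedding.isGδ_range`), and the two ranges have
full measure with respect to the same distribution of codes (`IsCoding.map_eq`), so that restricting
to the common codes retains invariant `G_δ` sets of full measure.
-/

open Filter Topology
open scoped ENNReal
open Cardinal (cantorFunction cantorFunctionAux_nonneg cantorFunction_injective)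

set_option linter.unusedSectionVars false

/-! ### Locally constant labellings and maps that are locally powers of `T` -/

section Local

variable {X : Type u} [TopologicalSpace X] {ι : Type*} {κ : Type*}

/-- The function `f`, thought of as a labelling by a discrete set, is constant near `x`.
A set `A` is regarded as the labelling `(· ∈ A)`. -/
def LCAt (f : X → ι) (x : X) : Prop := ∀ᶠ y in 𝓝 x, f y = f x

/-- Near `x` the map `f` coincides with a single power of `T`. -/
def PowAt (T : X ≃ₜ X) (f : X → X) (x : X) : Prop := ∃ k : ℤ, ∀ᶠ y in 𝓝 x, f y = (T ^ k) y

theorem LCAt.comp {f : X → ι} {x : X} (h : LCAt f x) (g : ι → κ) : LCAt (fun y => g (f y)) x :=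
  Eventually.mono h fun y hy => by simp only [hy]

theorem LCAt.const (c : ι) (x : X) : LCAt (fun _ => c) x := Eventually.of_forall fun _ => rfl

theorem LCAt.prodMk {f : X → ι} {g : X → κ} {x : X} (hf : LCAt f x) (hg : LCAt g x) :
    LCAt (fun y => (f y, g y)) x := by
  filter_upwards [hf, hg] with y h1 h2
  rw [h1, h2]

theorem LCAt.pi [Finite κ] {f : κ → X → ι} {x : X} (hf : ∀ k, LCAt (f k) x) :
    LCAt (fun y k => f k y) x := by
  filter_upwards [eventually_all.2 hf] with y h1
  funext k
  exact h1 k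

/-- A function assembled from functions `F i` according to a locally constant label is locally
constant as soon as the relevant `F i` is. -/
theorem LCAt.dep {l : X → ι} {F : ι → X → κ} {x : X} (hl : LCAt l x) (hF : LCAt (F (l x)) x) :
    LCAt (fun y => F (l y) y) x := by
  filter_upwards [hl, hF] with y h1 h2
  rw [h1, h2]

theorem LCAt.and {p q : X → Prop} {x : X} (hp : LCAt p x) (hq : LCAt q x) :
    LCAt (fun y => p y ∧ q y) x := by
  filter_upwards [hp, hq] with y h1 h2
  rw [h1, h2]

theorem LCAt.not {p : X → Prop} {x : X} (hp : LCAt p x) : LCAt (fun y => ¬ p y) x :=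
  hp.comp (fun a => ¬ a)

theorem LCAt.forall_finite [Finite κ] {p : κ → X → Prop} {x : X} (hp : ∀ k, LCAt (p k) x) :
    LCAt (fun y => ∀ k, p k y) x :=
  (LCAt.pi hp).comp (fun a : κ → Prop => ∀ k, a k)

theorem LCAt.mem_interior {p : X → Prop} {x : X} (hp : LCAt p x) (hx : p x) :
    x ∈ interior {y | p y} := by
  rw [mem_interior_iff_mem_nhds]
  filter_upwards [hp] with y hy
  exact (iff_of_eq hy).2 hx

theorem lcAt_of_eventually {p : X → Prop} {x : X} (hp : ∀ᶠ y in 𝓝 x, p y) : LCAt p x := by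
  filter_upwards [hp] with y hy
  exact propext ⟨fun _ => hp.self_of_nhds, fun _ => hy⟩

theorem lcAt_of_notMem_frontier {A : Set X} {x : X} (h : x ∉ frontier A) : LCAt (· ∈ A) x := by
  by_cases hx : x ∈ A
  · have : x ∈ interior A := by
      by_contra h'
      exact h ⟨subset_closure hx, h'⟩
    exact lcAt_of_eventually (mem_interior_iff_mem_nhds.1 this)
  · have : x ∉ closure A := fun h' => h ⟨h', fun h'' => hx (interior_subset h'')⟩
    have h2 : LCAt (· ∉ A) x :=
      lcAt_of_eventually (mem_of_superset (isClosed_closure.isOpen_compl.mem_nhds this)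
        fun y hy hyA => hy (subset_closure hyA))
    filter_upwards [h2] with y hy
    exact propext (not_iff_not.1 (iff_of_eq hy))

theorem LCAt.notMem_frontier {A : Set X} {x : X} (h : LCAt (· ∈ A) x) : x ∉ frontier A := by
  intro hx
  by_cases hA : x ∈ A
  · exact hx.2 (h.mem_interior hA)
  · have h1 := (LCAt.not h).mem_interior hA
    have h2 : x ∈ closure A := hx.1
    rw [closure_eq_compl_interior_compl] at h2
    exact h2 h1

/-- The first index at which one of countably many locally constant conditions holds is locally
constant. -/
theorem LCAt.firstIndex {p : ℕ → X → Prop} {x : X} (hp : ∀ n, LCAt (p n) x) (hx : ∃ n, p n x) :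
    LCAt (fun y => sInf {n | p n y}) x := by
  have h0 : p (sInf {n | p n x}) x := Nat.sInf_mem (s := {n | p n x}) hx
  set N := sInf {n | p n x} with hN
  have h1 : ∀ᶠ y in 𝓝 x, ∀ i : Fin (N + 1), p i y = p i x := eventually_all.2 fun i => hp i
  filter_upwards [h1] with y hy
  have hyN : p N y := by
    have := hy ⟨N, by omega⟩
    simp only at this
    rw [this]; exact h0
  apply le_antisymm
  · exact Nat.sInf_le hyN
  · have hmem : p (sInf {n | p n y}) y := Nat.sInf_mem (s := {n | p n y}) ⟨N, hyN⟩
    have hle : sInf {n | p n y} ≤ N := Nat.sInf_le hyN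
    have := hy ⟨sInf {n | p n y}, by omega⟩
    simp only at this
    rw [this] at hmem
    exact Nat.sInf_le hmem

variable {T : X ≃ₜ X}

theorem PowAt.zpow (T : X ≃ₜ X) (k : ℤ) (x : X) : PowAt T (fun y => (T ^ k) y) x :=
  ⟨k, Eventually.of_forall fun _ => rfl⟩

theorem PowAt.congr {f g : X → X} {x : X} (hf : PowAt T f x) (h : g =ᶠ[𝓝 x] f) : PowAt T g x := by
  obtain ⟨k, hk⟩ := hf
  refine ⟨k, ?_⟩
  filter_upwards [hk, h] with y h1 h2
  rw [h2, h1]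

theorem PowAt.exists_eq {f : X → X} {x : X} (hf : PowAt T f x) : ∃ k : ℤ, f x = (T ^ k) x :=
  ⟨hf.choose, hf.choose_spec.self_of_nhds⟩

theorem PowAt.continuousAt {f : X → X} {x : X} (hf : PowAt T f x) : ContinuousAt f x := by
  obtain ⟨k, hk⟩ := hf
  exact ((T ^ k).continuous.continuousAt).congr (hk.mono fun y hy => hy.symm)

theorem PowAt.comp {f g : X → X} {x : X} (hg : PowAt T g (f x)) (hf : PowAt T f x) :
    PowAt T (fun y => g (f y)) x := by
  have hc := hf.continuousAt
  obtain ⟨k, hk⟩ := hf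
  obtain ⟨m, hm⟩ := hg
  refine ⟨m + k, ?_⟩
  filter_upwards [hk, hc.eventually hm] with y h1 h2
  rw [h2, h1, zpow_add]
  rfl

theorem LCAt.comp_powAt {f : X → X} {l : X → ι} {x : X} (hl : LCAt l (f x)) (hf : PowAt T f x) :
    LCAt (fun y => l (f y)) x :=
  hf.continuousAt.eventually hl

theorem PowAt.dep {l : X → ι} {F : ι → X → X} {x : X} (hl : LCAt l x)
    (hF : PowAt T (F (l x)) x) : PowAt T (fun y => F (l y) y) x :=
  hF.congr (hl.mono fun y hy => by simp only [hy])

theorem zpow_add_apply (T : X ≃ₜ X) (j k : ℤ) (x : X) : (T ^ (j + k)) x = (T ^ j) ((T ^ k) x) := by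
  rw [zpow_add]; rfl

theorem zpow_neg_apply_zpow (T : X ≃ₜ X) (k : ℤ) (x : X) : (T ^ (-k)) ((T ^ k) x) = x := by
  rw [← zpow_add_apply]; simp

theorem zpow_apply_zpow_neg (T : X ≃ₜ X) (k : ℤ) (x : X) : (T ^ k) ((T ^ (-k)) x) = x := by
  rw [← zpow_add_apply]; simp

theorem zpow_natCast_apply (T : X ≃ₜ X) (n : ℕ) (x : X) : (T ^ (n : ℤ)) x = T^[n] x := by
  induction n generalizing x with
  | zero => rfl
  | succ n ih =>
    rw [Function.iterate_succ_apply, ← ih, Nat.cast_succ, zpow_add_apply]; rfl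

end Local

/-! ### Invariant `G_δ` sets of full measure -/

section Core

variable {X : Type u} [TopologicalSpace X] [MeasurableSpace X] [BorelSpace X] {ι : Type*}

/-- An invariant `G_δ` set of full measure. All almost everywhere statements are proved on such
sets, because `φ` has to be defined on one. -/
structure IsCore (T : X ≃ₜ X) (μ : Measure X) (Z : Set X) : Prop where
  isGδ : IsGδ Z
  preimage_eq : T ⁻¹' Z = Z
  null : μ Zᶜ = 0

variable {T : X ≃ₜ X} {μ : Measure X}

theorem IsCore.zpow_mem_iff {Z : Set X} (h : IsCore T μ Z) (k : ℤ) (x : X) :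
    (T ^ k) x ∈ Z ↔ x ∈ Z := by
  have h1 : ∀ x, T x ∈ Z ↔ x ∈ Z := fun x => by
    conv_rhs => rw [← h.preimage_eq]
    rfl
  induction k generalizing x with
  | zero => rfl
  | succ n ih => rw [zpow_add_apply]; exact (ih _).trans (h1 x)
  | pred n ih =>
    rw [sub_eq_add_neg, zpow_add_apply]
    refine (ih _).trans ?_
    rw [← h1]
    exact iff_of_eq (congrArg (· ∈ Z) (zpow_apply_zpow_neg T 1 x))

theorem IsCore.zpow_mem {Z : Set X} (h : IsCore T μ Z) (k : ℤ) {x : X} (hx : x ∈ Z) :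
    (T ^ k) x ∈ Z := (h.zpow_mem_iff k x).2 hx

theorem IsCore.powAt_mem {Z : Set X} (h : IsCore T μ Z) {f : X → X} {x : X} (hf : PowAt T f x)
    (hx : x ∈ Z) : f x ∈ Z := by
  obtain ⟨k, hk⟩ := hf.exists_eq
  rw [hk]; exact h.zpow_mem k hx

theorem IsCore.ae_mem {Z : Set X} (h : IsCore T μ Z) : ∀ᵐ x ∂μ, x ∈ Z := h.null

theorem IsCore.univ (T : X ≃ₜ X) (μ : Measure X) : IsCore T μ (univ : Set X) :=
  ⟨IsGδ.univ, rfl, by simp⟩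

theorem IsCore.iInter [Countable ι] {Z : ι → Set X} (h : ∀ i, IsCore T μ (Z i)) :
    IsCore T μ (⋂ i, Z i) where
  isGδ := IsGδ.iInter fun i => (h i).isGδ
  preimage_eq := by rw [preimage_iInter]; exact iInter_congr fun i => (h i).preimage_eq
  null := by rw [compl_iInter, measure_iUnion_null_iff]; exact fun i => (h i).null

theorem IsCore.inter {Z W : Set X} (h : IsCore T μ Z) (h' : IsCore T μ W) :
    IsCore T μ (Z ∩ W) where
  isGδ := h.isGδ.inter h'.isGδ
  preimage_eq := by rw [preimage_inter, h.preimage_eq, h'.preimage_eq]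
  null := by rw [compl_inter, measure_union_null_iff]; exact ⟨h.null, h'.null⟩

theorem measurePreserving_zpow (hT : MeasurePreserving T μ μ) (k : ℤ) :
    MeasurePreserving (T ^ k : X ≃ₜ X) μ μ := by
  have hs : MeasurePreserving (T ^ (-1 : ℤ) : X ≃ₜ X) μ μ :=
    MeasurePreserving.symm T.toMeasurableEquiv hT
  induction k with
  | zero => exact MeasurePreserving.id μ
  | succ n ih =>
    have : ((T ^ ((n : ℤ) + 1) : X ≃ₜ X) : X → X) = (T ^ (n : ℤ) : X ≃ₜ X) ∘ T := by
      funext x; rw [zpow_add_apply]; rfl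
    rw [this]; exact ih.comp hT
  | pred n ih =>
    have : ((T ^ (-(n : ℤ) - 1) : X ≃ₜ X) : X → X)
        = (T ^ (-(n : ℤ)) : X ≃ₜ X) ∘ (T ^ (-1 : ℤ) : X ≃ₜ X) := by
      funext x; rw [sub_eq_add_neg, zpow_add_apply]; rfl
    rw [this]; exact ih.comp hs

theorem measure_zpow_preimage (hT : MeasurePreserving T μ μ) (k : ℤ) (A : Set X) :
    μ ((T ^ k : X ≃ₜ X) ⁻¹' A) = μ A :=
  (measurePreserving_zpow hT k).measure_preimage_equiv (f := (T ^ k : X ≃ₜ X).toMeasurableEquiv) A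

theorem measure_zpow_image (hT : MeasurePreserving T μ μ) (k : ℤ) (A : Set X) :
    μ ((T ^ k : X ≃ₜ X) '' A) = μ A := by
  rw [← measure_zpow_preimage hT k ((T ^ k : X ≃ₜ X) '' A),
    preimage_image_eq _ (T ^ k : X ≃ₜ X).injective]

/-- Every `G_δ` set of full measure contains an invariant one. -/
theorem exists_isCore_subset (hT : MeasurePreserving T μ μ) {G : Set X} (hG : IsGδ G)
    (h0 : μ Gᶜ = 0) : ∃ Z ⊆ G, IsCore T μ Z := by
  refine ⟨⋂ k : ℤ, (T ^ k : X ≃ₜ X) ⁻¹' G, fun x hx => ?_, ?_, ?_, ?_⟩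
  · simpa using mem_iInter.1 hx 0
  · exact IsGδ.iInter fun k => hG.preimage (T ^ k : X ≃ₜ X).continuous
  · ext x
    simp only [mem_preimage, mem_iInter]
    constructor
    · intro h k
      have := h (k - 1)
      rwa [show T x = (T ^ (1 : ℤ)) x from rfl, ← zpow_add_apply, sub_add_cancel] at this
    · intro h k
      rw [show T x = (T ^ (1 : ℤ)) x from rfl, ← zpow_add_apply]
      exact h _
  · rw [compl_iInter, measure_iUnion_null_iff]
    intro k
    rw [← preimage_compl, measure_zpow_preimage hT, h0]

/-- Countably many labellings, each locally constant almost everywhere, are locally constant on a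
common core. -/
theorem exists_isCore_lcAt [Countable ι] {κ : ι → Type*} (hT : MeasurePreserving T μ μ)
    (f : ∀ i, X → κ i) (hf : ∀ i, ∀ᵐ x ∂μ, LCAt (f i) x) :
    ∃ Z, IsCore T μ Z ∧ ∀ x ∈ Z, ∀ i, LCAt (f i) x := by
  have hopen : ∀ i, IsOpen {x | LCAt (f i) x} := by
    intro i
    rw [isOpen_iff_mem_nhds]
    intro x hx
    have := eventually_eventually_nhds.2 hx
    filter_upwards [this, hx] with y hy hyx
    filter_upwards [hy] with z hz
    rw [hz, hyx]
  obtain ⟨Z, hZ, hc⟩ := exists_isCore_subset hT (IsGδ.iInter_of_isOpen hopen) (by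
    rw [compl_iInter, measure_iUnion_null_iff]
    exact fun i => hf i)
  exact ⟨Z, hc, fun x hx i => mem_iInter.1 (hZ hx) i⟩

theorem exists_isCore_lcAt_set [Countable ι] (hT : MeasurePreserving T μ μ)
    (A : ι → Set X) (hA : ∀ i, μ (frontier (A i)) = 0) :
    ∃ Z, IsCore T μ Z ∧ ∀ x ∈ Z, ∀ i, LCAt (· ∈ A i) x :=
  exists_isCore_lcAt hT (fun i x => x ∈ A i) fun i =>
    (measure_eq_zero_iff_ae_notMem.1 (hA i)).mono fun _ hx => lcAt_of_notMem_frontier hx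

theorem exists_isCore_lcAt_one {κ : Type*} (hT : MeasurePreserving T μ μ)
    (f : X → κ) (hf : ∀ᵐ x ∂μ, LCAt f x) :
    ∃ Z, IsCore T μ Z ∧ ∀ x ∈ Z, LCAt f x := by
  obtain ⟨Z, h1, h2⟩ := exists_isCore_lcAt (ι := Unit) hT (fun _ => f) (fun _ => hf)
  exact ⟨Z, h1, fun x hx => h2 x hx ()⟩

/-- If almost every point satisfies one of countably many conditions, each of them locally constant
on a core, then all points of a smaller core do. -/
theorem exists_isCore_of_ae_exists [Countable ι] (hT : MeasurePreserving T μ μ) {Z : Set X}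
    (hZ : IsCore T μ Z) (p : ι → X → Prop) (hp : ∀ x ∈ Z, ∀ i, LCAt (p i) x)
    (hae : ∀ᵐ x ∂μ, ∃ i, p i x) : ∃ W ⊆ Z, IsCore T μ W ∧ ∀ x ∈ W, ∃ i, p i x := by
  obtain ⟨W, hW, hc⟩ := exists_isCore_subset (μ := μ) hT
    (G := ⋃ i, interior {x | p i x}) (isOpen_iUnion fun i => isOpen_interior).isGδ (by
      rw [← mem_ae_iff]
      filter_upwards [hae, hZ.ae_mem] with x ⟨i, hi⟩ hx
      exact mem_iUnion.2 ⟨i, (hp x hx i).mem_interior hi⟩)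
  refine ⟨Z ∩ W, inter_subset_left, hZ.inter hc, fun x hx => ?_⟩
  obtain ⟨i, hi⟩ := mem_iUnion.1 (hW hx.2)
  exact ⟨i, interior_subset hi⟩

theorem IsCore.frontier_null {Z : Set X} (hZ : IsCore T μ Z) {A : Set X}
    (hA : ∀ x ∈ Z, LCAt (· ∈ A) x) : μ (frontier A) = 0 :=
  measure_mono_null (fun x hx hxZ => (hA x hxZ).notMem_frontier hx) hZ.null

theorem IsCore.nullMeasurableSet {Z : Set X} (hZ : IsCore T μ Z) {A : Set X}
    (hA : ∀ x ∈ Z, LCAt (· ∈ A) x) : NullMeasurableSet A μ :=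
  nullMeasurableSet_of_null_frontier (hZ.frontier_null hA)

theorem null_frontier_zpow_preimage (hT : MeasurePreserving T μ μ) (k : ℤ) {A : Set X}
    (hA : μ (frontier A) = 0) : μ (frontier ((T ^ k : X ≃ₜ X) ⁻¹' A)) = 0 := by
  rw [← Homeomorph.preimage_frontier, measure_zpow_preimage hT, hA]

theorem null_frontier_diff {A B : Set X} (hA : μ (frontier A) = 0) (hB : μ (frontier B) = 0) :
    μ (frontier (A \ B)) = 0 := by
  rw [sdiff_eq]; exact null_frontier_inter hA (by rwa [frontier_compl])

/-- A map which is locally a power of `T` and injective does not decrease measure. -/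
theorem measure_le_of_powAt (hT : MeasurePreserving T μ μ) {Z A B : Set X}
    {f : X → X} (hf : ∀ x ∈ A, x ∈ Z → PowAt T f x) (hZ : IsCore T μ Z)
    (hinj : InjOn f (A ∩ Z)) (hmap : ∀ x ∈ A, x ∈ Z → f x ∈ B)
    (hA : NullMeasurableSet A μ) : μ A ≤ μ B := by
  obtain ⟨A', hA'A, hA'm, hA'ae⟩ := hA.exists_measurable_subset_ae_eq
  let e : ℕ ≃ ℤ := Equiv.intEquivNat.symm
  let V : ℕ → Set X := fun n => interior {x | f x = (T ^ (e n)) x}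
  have hV : ∀ n, MeasurableSet (disjointed V n) := fun n =>
    MeasurableSet.disjointed (fun n => isOpen_interior.measurableSet) n
  have hm : ∀ n, MeasurableSet (A' ∩ Z ∩ disjointed V n) := fun n =>
    (hA'm.inter hZ.isGδ.measurableSet).inter (hV n)
  have hVf : ∀ n, ∀ x ∈ disjointed V n, f x = (T ^ (e n)) x := fun n x hx =>
    (interior_subset (disjointed_subset V n hx) :)
  have hcov : A' ∩ Z ⊆ ⋃ n, A' ∩ Z ∩ disjointed V n := by
    intro x hx
    rw [← inter_iUnion, iUnion_disjointed]
    refine ⟨hx, ?_⟩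
    obtain ⟨k, hk⟩ := hf x (hA'A hx.1) hx.2
    refine mem_iUnion.2 ⟨e.symm k, ?_⟩
    change x ∈ interior _
    rw [Equiv.apply_symm_apply]
    exact mem_interior_iff_mem_nhds.2 hk
  have himg : ∀ n, f '' (A' ∩ Z ∩ disjointed V n)
      = (T ^ (e n) : X ≃ₜ X) '' (A' ∩ Z ∩ disjointed V n) := fun n =>
    image_congr fun x hx => hVf n x hx.2
  calc μ A = μ A' := (measure_congr hA'ae).symm
    _ = μ (A' ∩ Z) := by
      refine (measure_congr ?_)
      filter_upwards [hZ.ae_mem] with x hx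
      exact propext ⟨fun h => ⟨h, hx⟩, fun h => h.1⟩
    _ ≤ μ (⋃ n, A' ∩ Z ∩ disjointed V n) := measure_mono hcov
    _ ≤ ∑' n, μ (A' ∩ Z ∩ disjointed V n) := measure_iUnion_le _
    _ = ∑' n, μ (f '' (A' ∩ Z ∩ disjointed V n)) := by
      congr 1; funext n; rw [himg, measure_zpow_image hT]
    _ = μ (⋃ n, f '' (A' ∩ Z ∩ disjointed V n)) := by
      rw [measure_iUnion]
      · intro i j hij
        rw [Function.onFun, Set.disjoint_left]
        rintro _ ⟨x, hx, rfl⟩ ⟨y, hy, hxy⟩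
        have : y = x := hinj ⟨hA'A hy.1.1, hy.1.2⟩ ⟨hA'A hx.1.1, hx.1.2⟩ hxy
        subst this
        exact Set.disjoint_left.1 (disjoint_disjointed V hij) hx.2 hy.2
      · intro n
        rw [himg]
        exact ((T ^ (e n) : X ≃ₜ X).measurableEmbedding.measurableSet_image).2 (hm n)
    _ ≤ μ B := by
      apply measure_mono
      rintro y hy
      obtain ⟨n, x, hx, rfl⟩ := mem_iUnion.1 hy
      exact hmap x (hA'A hx.1.1) hx.1.2

end Core

/-! ### Cutting sets to prescribed measure -/

section Coordinate

variable {X : Type u} [TopologicalSpace X] [MeasurableSpace X] [BorelSpace X]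

/-- All but countably many of the balls about a point have null boundary, so a Polish space has a
countable base of open sets with null boundary. -/
theorem exists_null_frontier_basis [PolishSpace X] [Nonempty X] (μ : Measure X) [SigmaFinite μ] :
    ∃ U : ℕ → Set X, (∀ j, IsOpen (U j)) ∧ (∀ j, μ (frontier (U j)) = 0) ∧
      ∀ x, ∀ V ∈ 𝓝 x, ∃ j, x ∈ U j ∧ U j ⊆ V := by
  let _ := TopologicalSpace.upgradeIsCompletelyMetrizable X
  have hr : ∀ p : ℕ × ℕ, ∃ r ∈ Ioo (1 / ((p.2 : ℝ) + 2)) (1 / ((p.2 : ℝ) + 1)),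
      μ (frontier (Metric.thickening r {TopologicalSpace.denseSeq X p.1})) = 0 := fun p =>
    exists_null_frontier_thickening μ _ (one_div_lt_one_div_of_lt (by positivity) (by linarith))
  choose r hr hr0 using hr
  refine ⟨fun j => Metric.ball (TopologicalSpace.denseSeq X (Nat.unpair j).1) (r (Nat.unpair j)),
    fun j => Metric.isOpen_ball, fun j => ?_, fun x V hV => ?_⟩
  · simp only [← Metric.thickening_singleton]; exact hr0 _
  · obtain ⟨ε, hε, hεV⟩ := Metric.mem_nhds_iff.1 hV
    obtain ⟨n, hn⟩ := exists_nat_one_div_lt (half_pos hε)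
    obtain ⟨i, hi⟩ := (TopologicalSpace.denseRange_denseSeq X).exists_dist_lt x
      (ε := 1 / ((n : ℝ) + 2)) (by positivity)
    refine ⟨Nat.pair i n, ?_, fun y hy => hεV ?_⟩
    · simp only [Nat.unpair_pair, Metric.mem_ball]
      exact hi.trans (hr (i, n)).1
    · simp only [Nat.unpair_pair, Metric.mem_ball] at hy
      rw [Metric.mem_ball]
      have h1 := (hr (i, n)).1
      have h2 := (hr (i, n)).2
      simp only at h1 h2
      have h3 := dist_triangle y (TopologicalSpace.denseSeq X i) x
      rw [dist_comm (TopologicalSpace.denseSeq X i) x] at h3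
      linarith

/-- An almost everywhere continuous real function with null level sets, along which `X` can be cut
into pieces of prescribed measure. -/
structure IsCoordinate (μ : Measure X) (g : X → ℝ) : Prop where
  ae_continuousAt : ∀ᵐ x ∂μ, ContinuousAt g x
  level_null : ∀ t, μ {x | g x = t} = 0
  lt_ne_top : ∀ t, μ {x | g x < t} ≠ ⊤
  nonneg : ∀ x, 0 ≤ g x

theorem continuous_cantorFunction {c : ℝ} (h0 : 0 ≤ c) (h1 : c < 1) :
    Continuous (cantorFunction c) := by
  unfold cantorFunction
  refine continuous_tsum (u := fun n => c ^ n) (fun n => ?_)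
    (summable_geometric_of_lt_one h0 h1) fun n f => ?_
  · exact (continuous_of_discreteTopology (f := fun b : Bool => cond b (c ^ n) 0)).comp
      (continuous_apply n)
  · cases h : f n <;> simp [h, abs_of_nonneg h0, pow_nonneg h0]

open Classical in
/-- The integer part of the coordinate is the index of the first basic open set of finite measure
containing the point; its fractional part encodes the whole list of basic open sets containing the
point, so that distinct points with the same integer part are separated. -/
theorem exists_isCoordinate [PolishSpace X] (μ : Measure X) [NullSingletonClass μ]
    {U : ℕ → Set X} (hU0 : ∀ j, μ (frontier (U j)) = 0)
    (hU : ∀ x, ∀ V ∈ 𝓝 x, ∃ j, x ∈ U j ∧ U j ⊆ V)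
    (hfin : ∀ᵐ x ∂μ, ∃ V ∈ 𝓝 x, μ V ≠ ⊤) : ∃ g, IsCoordinate μ g := by
  set code : X → ℕ → Bool := fun x j => decide (x ∈ U j) with hcode
  set n : X → ℕ := fun x => sInf {j | x ∈ U j ∧ μ (U j) ≠ ⊤} with hn
  have hcinj : Function.Injective code := by
    intro x y hxy
    by_contra hne
    obtain ⟨j, hxj, hj⟩ := hU x {y}ᶜ (isOpen_compl_singleton.mem_nhds hne)
    have := congrFun hxy j
    simp only [hcode, decide_eq_decide] at this
    exact hj (this.1 hxj) rfl
  have hex : ∀ᵐ x ∂μ, ∃ j, x ∈ U j ∧ μ (U j) ≠ ⊤ := by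
    filter_upwards [hfin] with x ⟨V, hV, hVf⟩
    obtain ⟨j, hxj, hj⟩ := hU x V hV
    exact ⟨j, hxj, ne_top_of_le_ne_top hVf (measure_mono hj)⟩
  have hlc : ∀ᵐ x ∂μ, ∀ j, LCAt (· ∈ U j) x := by
    rw [ae_all_iff]
    intro j
    filter_upwards [measure_eq_zero_iff_ae_notMem.1 (hU0 j)] with x hx
    exact lcAt_of_notMem_frontier hx
  have hc0 : ∀ f, 0 ≤ cantorFunction (1 / 3) f := fun f =>
    tsum_nonneg fun k => cantorFunctionAux_nonneg (by norm_num)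
  refine ⟨fun x => n x + cantorFunction (1 / 3) (code x), ?_, ?_, ?_, ?_⟩
  · filter_upwards [hex, hlc] with x hx hl
    have h1 : LCAt n x := LCAt.firstIndex (p := fun j x => x ∈ U j ∧ μ (U j) ≠ ⊤)
      (fun j => (hl j).and (LCAt.const _ x)) hx
    have h2 : ContinuousAt code x := by
      rw [continuousAt_pi]
      intro j
      have : LCAt (fun y => code y j) x := (hl j).comp (fun p : Prop => decide p)
      exact (continuousAt_const (y := code x j)).congr (this.mono fun y hy => hy.symm)
    have h3 : ContinuousAt (fun y => (n y : ℝ)) x :=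
      (continuousAt_const (y := (n x : ℝ))).congr (h1.mono fun y hy => by simp only [hy])
    exact h3.add (((continuous_cantorFunction (by norm_num) (by norm_num)).continuousAt).comp h2)
  · intro t
    refine measure_mono_null (t := ⋃ k : ℕ, {x | cantorFunction (1 / 3) (code x) = t - k}) ?_ ?_
    · intro x hx
      refine mem_iUnion.2 ⟨n x, ?_⟩
      have : (n x : ℝ) + cantorFunction (1 / 3) (code x) = t := hx
      change cantorFunction (1 / 3) (code x) = t - n x
      linarith
    · rw [measure_iUnion_null_iff]
      intro k
      refine Set.Subsingleton.measure_zero (fun x hx y hy => hcinj ?_) μ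
      exact cantorFunction_injective (by norm_num) (by norm_num)
        ((show _ = t - (k : ℝ) from hx).trans (show _ = t - (k : ℝ) from hy).symm)
  · intro t
    obtain ⟨N, hN⟩ := exists_nat_gt t
    have hsub : {x | n x + cantorFunction (1 / 3) (code x) < t} ⊆
        (⋃ j ∈ {j ∈ Finset.range N | μ (U j) ≠ ⊤}, U j) ∪
          {x | ¬ ∃ j, x ∈ U j ∧ μ (U j) ≠ ⊤} := by
      intro x hx
      by_cases hxe : ∃ j, x ∈ U j ∧ μ (U j) ≠ ⊤
      · left
        have hmem : x ∈ U (n x) ∧ μ (U (n x)) ≠ ⊤ :=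
          Nat.sInf_mem (s := {j | x ∈ U j ∧ μ (U j) ≠ ⊤}) hxe
        have : (n x : ℝ) + cantorFunction (1 / 3) (code x) < t := hx
        have h1 : (n x : ℝ) < N := by linarith [hc0 (code x)]
        exact mem_iUnion₂.2 ⟨n x, Finset.mem_filter.2
          ⟨Finset.mem_range.2 (by exact_mod_cast h1), hmem.2⟩, hmem.1⟩
      · exact Or.inr hxe
    refine ne_top_of_le_ne_top ?_ ((measure_mono hsub).trans (measure_union_le _ _))
    rw [show μ {x | ¬ ∃ j, x ∈ U j ∧ μ (U j) ≠ ⊤} = 0 from hex, add_zero]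
    refine ne_top_of_le_ne_top ?_ (measure_biUnion_finset_le _ _)
    exact ENNReal.sum_ne_top.2 fun j hj => (Finset.mem_filter.1 hj).2
  · intro x
    have := hc0 (code x)
    positivity

variable {μ : Measure X} {g : X → ℝ}

theorem IsCoordinate.null_frontier_lt (hg : IsCoordinate μ g) (t : ℝ) :
    μ (frontier {x | g x < t}) = 0 := by
  rw [measure_eq_zero_iff_ae_notMem]
  filter_upwards [hg.ae_continuousAt, measure_eq_zero_iff_ae_notMem.1 (hg.level_null t)] with x h1 h2
  refine LCAt.notMem_frontier ?_
  rcases lt_or_gt_of_ne (show g x ≠ t from h2) with h | h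
  · exact lcAt_of_eventually (h1.eventually_lt_const h)
  · have : LCAt (· ∉ {x | g x < t}) x := lcAt_of_eventually
      ((h1.eventually_const_lt h).mono fun y hy => not_lt.2 (le_of_lt hy))
    simpa using this.not

theorem IsCoordinate.nullMeasurableSet_lt (hg : IsCoordinate μ g) (t : ℝ) :
    NullMeasurableSet {x | g x < t} μ :=
  nullMeasurableSet_of_null_frontier (hg.null_frontier_lt t)

/-- As the level sets of the coordinate are null, the measure of `A ∩ {g < t}` depends continuously
on `t`, so it takes all values below `μ A`. -/
theorem IsCoordinate.exists_measure_inter_lt_eq (hg : IsCoordinate μ g) {A : Set X}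
    (hA : NullMeasurableSet A μ) {c : ℝ≥0∞} (hc : c < μ A) :
    ∃ t, μ (A ∩ {x | g x < t}) = c := by
  have hmono : ∀ {s t : ℝ}, s ≤ t → A ∩ {x | g x < s} ⊆ A ∩ {x | g x < t} := fun h =>
    inter_subset_inter_right _ fun x (hx : g x < _) => hx.trans_le h
  set S : Set ℝ := {s | μ (A ∩ {x | g x < s}) ≤ c}
  have h0 : (0 : ℝ) ∈ S := by
    have : A ∩ {x | g x < 0} = ∅ := by
      ext x
      simpa using fun _ => hg.nonneg x
    change μ _ ≤ c
    rw [this]; simp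
  have hbdd : BddAbove S := by
    have : A = ⋃ n : ℕ, A ∩ {x | g x < n} := by
      rw [← inter_iUnion, eq_comm, inter_eq_left]
      intro x _
      obtain ⟨n, hn⟩ := exists_nat_gt (g x)
      exact mem_iUnion.2 ⟨n, hn⟩
    rw [this, Monotone.measure_iUnion (fun i j hij => hmono (by exact_mod_cast hij)),
      lt_iSup_iff] at hc
    obtain ⟨n, hn⟩ := hc
    refine ⟨n, fun s hs => ?_⟩
    by_contra hns
    exact absurd ((measure_mono (hmono (not_le.1 hns).le)).trans hs) (not_le.2 hn)
  refine ⟨sSup S, le_antisymm ?_ ?_⟩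
  · have : A ∩ {x | g x < sSup S} = ⋃ n : ℕ, A ∩ {x | g x < sSup S - 1 / ((n : ℝ) + 1)} := by
      rw [← inter_iUnion]
      congr 1
      ext x
      simp only [mem_ofPred_eq, mem_iUnion]
      constructor
      · intro h
        obtain ⟨n, hn⟩ := exists_nat_one_div_lt (sub_pos.2 h)
        exact ⟨n, by linarith⟩
      · rintro ⟨n, hn⟩
        have : (0 : ℝ) < 1 / ((n : ℝ) + 1) := by positivity
        linarith
    rw [this, Monotone.measure_iUnion]
    · refine iSup_le fun n => ?_
      obtain ⟨s, hs, hlt⟩ := exists_lt_of_lt_csSup ⟨0, h0⟩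
        (show sSup S - 1 / ((n : ℝ) + 1) < sSup S by
          have : (0 : ℝ) < 1 / ((n : ℝ) + 1) := by positivity
          linarith)
      exact (measure_mono (hmono hlt.le)).trans hs
    · intro i j hij
      apply hmono
      have : 1 / ((j : ℝ) + 1) ≤ 1 / ((i : ℝ) + 1) :=
        one_div_le_one_div_of_le (by positivity) (by
          have : (i : ℝ) ≤ j := by exact_mod_cast hij
          linarith)
      linarith
  · have h1 : A ∩ {x | g x ≤ sSup S} = ⋂ n : ℕ, A ∩ {x | g x < sSup S + 1 / ((n : ℝ) + 1)} := by
      rw [← inter_iInter]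
      congr 1
      ext x
      simp only [mem_ofPred_eq, mem_iInter]
      constructor
      · intro h n
        have : (0 : ℝ) < 1 / ((n : ℝ) + 1) := by positivity
        linarith
      · intro h
        by_contra hlt
        obtain ⟨n, hn⟩ := exists_nat_one_div_lt (sub_pos.2 (not_le.1 hlt))
        linarith [h n]
    have h2 : c ≤ μ (A ∩ {x | g x ≤ sSup S}) := by
      rw [h1, Antitone.measure_iInter]
      · refine le_iInf fun n => ?_
        by_contra hlt
        have : sSup S + 1 / ((n : ℝ) + 1) ∈ S := (not_le.1 hlt).le
        have h3 := le_csSup hbdd this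
        have : (0 : ℝ) < 1 / ((n : ℝ) + 1) := by positivity
        linarith
      · intro i j hij
        apply hmono
        have : 1 / ((j : ℝ) + 1) ≤ 1 / ((i : ℝ) + 1) :=
          one_div_le_one_div_of_le (by positivity) (by
            have : (i : ℝ) ≤ j := by exact_mod_cast hij
            linarith)
        linarith
      · exact fun n => hA.inter (hg.nullMeasurableSet_lt _)
      · exact ⟨0, ne_top_of_le_ne_top (hg.lt_ne_top _) (measure_mono inter_subset_right)⟩
    refine h2.trans ?_
    have : A ∩ {x | g x ≤ sSup S} ⊆ (A ∩ {x | g x < sSup S}) ∪ {x | g x = sSup S} := by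
      rintro x ⟨hx, hxs⟩
      rcases lt_or_eq_of_le (show g x ≤ _ from hxs) with h | h
      · exact Or.inl ⟨hx, h⟩
      · exact Or.inr h
    refine (measure_mono this).trans ((measure_union_le _ _).trans ?_)
    rw [hg.level_null, add_zero]

/-- A set with null boundary can be cut to any smaller measure. -/
theorem IsCoordinate.exists_subset_measure_eq (hg : IsCoordinate μ g) {A : Set X}
    (hA : μ (frontier A) = 0) {c : ℝ≥0∞} (hc : c ≤ μ A) :
    ∃ C ⊆ A, μ (frontier C) = 0 ∧ μ C = c := by
  rcases hc.eq_or_lt with rfl | h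
  · exact ⟨A, Subset.rfl, hA, rfl⟩
  · obtain ⟨t, ht⟩ := hg.exists_measure_inter_lt_eq (nullMeasurableSet_of_null_frontier hA) h
    exact ⟨_, inter_subset_left, null_frontier_inter hA (hg.null_frontier_lt t), ht⟩

end Coordinate

/-! ### Recurrence and orbit equivalence of sets of equal measure -/

section Ergodic

variable {X : Type u} [TopologicalSpace X] [MeasurableSpace X] [BorelSpace X]
  {T : X ≃ₜ X} {μ : Measure X}

theorem Ergodic.ae_exists_zpow_mem (hT : Ergodic T μ) {A : Set X} (hA : NullMeasurableSet A μ)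
    (h0 : μ A ≠ 0) : ∀ᵐ x ∂μ, ∃ k : ℤ, (T ^ k) x ∈ A := by
  obtain ⟨A', hA'A, hA'm, hA'ae⟩ := hA.exists_measurable_subset_ae_eq
  have hinv : T ⁻¹' (⋃ k : ℤ, (T ^ k : X ≃ₜ X) ⁻¹' A') = ⋃ k : ℤ, (T ^ k : X ≃ₜ X) ⁻¹' A' := by
    ext x
    simp only [mem_preimage, mem_iUnion]
    constructor
    · rintro ⟨k, hk⟩
      refine ⟨k + 1, ?_⟩
      rw [zpow_add_apply]; exact hk
    · rintro ⟨k, hk⟩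
      refine ⟨k - 1, ?_⟩
      rwa [show T x = (T ^ (1 : ℤ)) x from rfl, ← zpow_add_apply, sub_add_cancel]
  rcases hT.toPreErgodic.ae_mem_or_ae_notMem
    (MeasurableSet.iUnion fun k => (T ^ k : X ≃ₜ X).measurable hA'm) hinv with h | h
  · filter_upwards [h] with x hx
    obtain ⟨k, hk⟩ := mem_iUnion.1 hx
    exact ⟨k, hA'A hk⟩
  · exfalso
    apply h0
    rw [← measure_congr hA'ae]
    refine measure_mono_null (fun x hx => ?_) h
    simp only [mem_compl_iff, mem_ofPred_eq, not_not]
    exact mem_iUnion.2 ⟨0, hx⟩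

/-- An ergodic automorphism of a non-atomic space has no wandering set of positive measure: by
ergodicity almost every orbit would meet each of two disjoint halves of such a set. -/
theorem IsCoordinate.conservative {g : X → ℝ} (hg : IsCoordinate μ g) (hT : Ergodic T μ) :
    Conservative T μ where
  toQuasiMeasurePreserving := hT.toMeasurePreserving.quasiMeasurePreserving
  exists_mem_iterate_mem' := by
    intro s hs h0
    by_contra! hcon
    obtain ⟨c, hc0, hc⟩ := exists_between (pos_iff_ne_zero.2 h0)
    obtain ⟨t, ht⟩ := hg.exists_measure_inter_lt_eq hs.nullMeasurableSet hc
    set C := s ∩ {x | g x < t} with hC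
    have hCm : NullMeasurableSet C μ := hs.nullMeasurableSet.inter (hg.nullMeasurableSet_lt t)
    have hsC : μ (s \ C) ≠ 0 := by
      intro h
      have h1 : μ s ≤ μ C + μ (s \ C) := (measure_mono (by
        intro x hx
        by_cases hxC : x ∈ C
        · exact Or.inl hxC
        · exact Or.inr ⟨hx, hxC⟩)).trans (measure_union_le _ _)
      rw [h, add_zero, ht] at h1
      exact absurd hc (not_lt.2 h1)
    obtain ⟨x, hx, k, hk⟩ := ((frequently_ae_mem_iff.2 hsC).and_eventually
      (hT.ae_exists_zpow_mem hCm (by rw [ht]; exact hc0.ne'))).exists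
    rcases lt_trichotomy k 0 with h | rfl | h
    · obtain ⟨n, rfl⟩ := Int.eq_negSucc_of_lt_zero h
      refine hcon _ hk.1 (n + 1) (Nat.succ_ne_zero n) ?_
      rw [← zpow_natCast_apply, ← zpow_add_apply]
      have : ((n + 1 : ℕ) : ℤ) + Int.negSucc n = 0 := by
        rw [Int.negSucc_eq]; push_cast; ring
      rw [this]; exact hx.1
    · exact hx.2 hk
    · lift k to ℕ using h.le
      refine hcon _ hx.1 k (by omega) ?_
      rw [← zpow_natCast_apply]; exact hk.1

theorem IsCoordinate.ae_exists_future_mem {g : X → ℝ} (hg : IsCoordinate μ g) (hT : Ergodic T μ)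
    {D : Set X} (hD : NullMeasurableSet D μ) (h0 : μ D ≠ 0) :
    ∀ᵐ x ∂μ, ∃ n : ℕ, (T ^ ((n : ℤ) + 1)) x ∈ D := by
  have h1 := (hg.conservative hT).ae_mem_imp_frequently_image_mem hD
  have h2 : ∀ᵐ x ∂μ, ∀ k : ℤ, (T ^ k) x ∈ D → ∃ᶠ n in atTop, T^[n] ((T ^ k) x) ∈ D :=
    ae_all_iff.2 fun k =>
      (measurePreserving_zpow hT.toMeasurePreserving k).quasiMeasurePreserving.ae h1
  filter_upwards [h2, hT.ae_exists_zpow_mem hD h0] with x hx ⟨k, hk⟩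
  obtain ⟨n, hn, hn'⟩ := (frequently_atTop.1 (hx k hk)) (k.natAbs + 1)
  rw [← zpow_natCast_apply, ← zpow_add_apply] at hn'
  refine ⟨(n + k - 1).toNat, ?_⟩
  rw [Int.toNat_of_nonneg (by omega)]
  convert hn' using 3
  ring

theorem IsCoordinate.ae_exists_past_mem {g : X → ℝ} (hg : IsCoordinate μ g) (hT : Ergodic T μ)
    {D : Set X} (hD : NullMeasurableSet D μ) (h0 : μ D ≠ 0) :
    ∀ᵐ x ∂μ, ∃ n : ℕ, (T ^ (-(n : ℤ))) x ∈ D := by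
  have hT' : Ergodic T.symm μ := Ergodic.symm (e := T.toMeasurableEquiv) hT
  filter_upwards [hg.ae_exists_future_mem hT' hD h0] with x ⟨n, hn⟩
  refine ⟨n + 1, ?_⟩
  have : T.symm = T⁻¹ := rfl
  rw [this, inv_zpow'] at hn
  exact_mod_cast hn

/-- Given sets `A`, `B` with a partial matching of their points along `T`-orbits already removed,
remove also the pairs `(x, Tᵏ x)` with `k` the next exponent in an enumeration of `ℤ`. -/
def hopfRemainder (T : X ≃ₜ X) (A B : Set X) : ℕ → Set X × Set X
  | 0 => (A, B)
  | n + 1 =>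
    ((hopfRemainder T A B n).1 \
      (T ^ (Equiv.intEquivNat.symm n) : X ≃ₜ X) ⁻¹' (hopfRemainder T A B n).2,
     (hopfRemainder T A B n).2 \
      (T ^ (-(Equiv.intEquivNat.symm n)) : X ≃ₜ X) ⁻¹' (hopfRemainder T A B n).1)

/-- Sets of equal finite measure with null boundary are equivalent under the full groupoid of `T`,
by a map which is almost everywhere locally a power of `T`. -/
theorem exists_hopf_equivalence (hT : Ergodic T μ) {A B : Set X} (hA : μ (frontier A) = 0)
    (hB : μ (frontier B) = 0) (hAB : μ A = μ B) (hfin : μ A ≠ ⊤) :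
    ∃ (Z : Set X) (a b : X → X), IsCore T μ Z ∧
      (∀ x ∈ Z, x ∈ A → PowAt T a x ∧ a x ∈ B ∧ b (a x) = x) ∧
      (∀ x ∈ Z, x ∈ B → PowAt T b x ∧ b x ∈ A ∧ a (b x) = x) := by
  have hmp := hT.toMeasurePreserving
  set e : ℕ ≃ ℤ := Equiv.intEquivNat.symm with he
  set P : ℕ → Set X := fun n => (hopfRemainder T A B n).1 with hP
  set Q : ℕ → Set X := fun n => (hopfRemainder T A B n).2 with hQ
  have hPs : ∀ n, P (n + 1) = P n \ (T ^ e n : X ≃ₜ X) ⁻¹' Q n := fun n => rfl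
  have hQs : ∀ n, Q (n + 1) = Q n \ (T ^ (-e n) : X ≃ₜ X) ⁻¹' P n := fun n => rfl
  have hfr : ∀ n, μ (frontier (P n)) = 0 ∧ μ (frontier (Q n)) = 0 := by
    intro n
    induction n with
    | zero => exact ⟨hA, hB⟩
    | succ n ih =>
      rw [hPs, hQs]
      exact ⟨null_frontier_diff ih.1 (null_frontier_zpow_preimage hmp _ ih.2),
        null_frontier_diff ih.2 (null_frontier_zpow_preimage hmp _ ih.1)⟩
  have hPm : ∀ n, NullMeasurableSet (P n) μ := fun n => nullMeasurableSet_of_null_frontier (hfr n).1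
  have hQm : ∀ n, NullMeasurableSet (Q n) μ := fun n => nullMeasurableSet_of_null_frontier (hfr n).2
  have hPanti : Antitone P := antitone_nat_of_succ_le fun n => by rw [hPs]; exact sdiff_subset
  have hQanti : Antitone Q := antitone_nat_of_succ_le fun n => by rw [hQs]; exact sdiff_subset
  have hmeas : ∀ n, μ (P n) = μ (Q n) := by
    intro n
    induction n with
    | zero => exact hAB
    | succ n ih =>
      have h1 := measure_inter_add_sdiff₀ (P n) ((hQm n).preimage
        (measurePreserving_zpow hmp (e n)).quasiMeasurePreserving)
      have h2 := measure_inter_add_sdiff₀ (Q n) ((hPm n).preimage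
        (measurePreserving_zpow hmp (-e n)).quasiMeasurePreserving)
      have h3 : μ (P n ∩ (T ^ e n : X ≃ₜ X) ⁻¹' Q n)
          = μ (Q n ∩ (T ^ (-e n) : X ≃ₜ X) ⁻¹' P n) := by
        rw [← measure_zpow_preimage hmp (e n) (Q n ∩ _)]
        congr 1
        ext x
        simp only [mem_inter_iff, mem_preimage, zpow_neg_apply_zpow]
        exact and_comm
      rw [hPs, hQs]
      have h4 : μ (P n ∩ (T ^ e n : X ≃ₜ X) ⁻¹' Q n) ≠ ⊤ := ne_top_of_le_ne_top hfin
        (measure_mono (inter_subset_left.trans (hPanti (Nat.zero_le n))))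
      rw [← h1, ← h2, ← h3] at ih
      exact (ENNReal.add_right_inj h4).1 ih
  -- The remainders have the same measure. Were it positive, ergodicity would provide a point `x` of
  -- one and a power `Tᵏ x` in the other, but such a pair is removed when the exponent `k` comes up.
  have hnull : μ (⋂ n, P n) = 0 := by
    by_contra h0
    have h1 : μ (⋂ n, P n) = μ (⋂ n, Q n) := by
      rw [hPanti.measure_iInter hPm ⟨0, hfin⟩, hQanti.measure_iInter hQm ⟨0, hAB ▸ hfin⟩]
      exact iInf_congr hmeas
    obtain ⟨x, hx, k, hk⟩ := ((frequently_ae_mem_iff.2 (h1 ▸ h0)).and_eventually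
      (hT.ae_exists_zpow_mem (NullMeasurableSet.iInter hPm) h0)).exists
    have h2 := mem_iInter.1 hk (e.symm (-k) + 1)
    rw [hPs, e.apply_symm_apply] at h2
    apply h2.2
    rw [mem_preimage, zpow_neg_apply_zpow]
    exact mem_iInter.1 hx _
  have hnull' : μ (⋂ n, Q n) = 0 := by
    rw [hQanti.measure_iInter hQm ⟨0, hAB ▸ hfin⟩, ← iInf_congr hmeas,
      ← hPanti.measure_iInter hPm ⟨0, hfin⟩, hnull]
  obtain ⟨Z₁, hZ₁, hl₁⟩ := exists_isCore_lcAt_set hmp P fun n => (hfr n).1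
  obtain ⟨Z₂, hZ₂, hl₂⟩ := exists_isCore_lcAt_set hmp Q fun n => (hfr n).2
  obtain ⟨Z₃, hZ₃s, hZ₃, hl₃⟩ := exists_isCore_of_ae_exists hmp hZ₁ (fun n x => x ∉ P n)
    (fun x hx n => (hl₁ x hx n).not) (by
      filter_upwards [measure_eq_zero_iff_ae_notMem.1 hnull] with x hx
      simpa using hx)
  obtain ⟨Z₄, hZ₄s, hZ₄, hl₄⟩ := exists_isCore_of_ae_exists hmp hZ₂ (fun n x => x ∉ Q n)
    (fun x hx n => (hl₂ x hx n).not) (by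
      filter_upwards [measure_eq_zero_iff_ae_notMem.1 hnull'] with x hx
      simpa using hx)
  -- `p x` and `q x` are the stages at which `x` is matched.
  set p : X → ℕ := fun x => sInf {n | x ∉ P (n + 1)} with hp
  set q : X → ℕ := fun x => sInf {n | x ∉ Q (n + 1)} with hq
  have hpP : ∀ x ∈ A, (∃ n, x ∉ P n) → x ∈ P (p x) ∧ x ∉ P (p x + 1) := by
    intro x hx ⟨n, hn⟩
    have hne : {n | x ∉ P (n + 1)}.Nonempty := ⟨n, fun h => hn (hPanti (Nat.le_succ n) h)⟩
    refine ⟨?_, Nat.sInf_mem hne⟩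
    rcases Nat.eq_zero_or_pos (p x) with h | h
    · rw [h]; exact hx
    · have := Nat.notMem_of_lt_sInf (show p x - 1 < p x by omega)
      simp only [mem_ofPred_eq, not_not] at this
      rwa [Nat.sub_add_cancel h] at this
  have hqQ : ∀ x ∈ B, (∃ n, x ∉ Q n) → x ∈ Q (q x) ∧ x ∉ Q (q x + 1) := by
    intro x hx ⟨n, hn⟩
    have hne : {n | x ∉ Q (n + 1)}.Nonempty := ⟨n, fun h => hn (hQanti (Nat.le_succ n) h)⟩
    refine ⟨?_, Nat.sInf_mem hne⟩
    rcases Nat.eq_zero_or_pos (q x) with h | h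
    · rw [h]; exact hx
    · have := Nat.notMem_of_lt_sInf (show q x - 1 < q x by omega)
      simp only [mem_ofPred_eq, not_not] at this
      rwa [Nat.sub_add_cancel h] at this
  have hpeq : ∀ x n, x ∈ P n → x ∉ P (n + 1) → p x = n := by
    intro x n h1 h2
    refine le_antisymm (Nat.sInf_le h2) (le_csInf ⟨n, h2⟩ fun m hm => ?_)
    by_contra hlt
    exact hm (hPanti (by omega) h1)
  have hqeq : ∀ x n, x ∈ Q n → x ∉ Q (n + 1) → q x = n := by
    intro x n h1 h2
    refine le_antisymm (Nat.sInf_le h2) (le_csInf ⟨n, h2⟩ fun m hm => ?_)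
    by_contra hlt
    exact hm (hQanti (by omega) h1)
  refine ⟨Z₃ ∩ Z₄, fun x => (T ^ e (p x)) x, fun x => (T ^ (-e (q x))) x, hZ₃.inter hZ₄, ?_, ?_⟩
  · intro x hx hxA
    obtain ⟨h1, h2⟩ := hpP x hxA (hl₃ x hx.1)
    have hlc : LCAt p x := LCAt.firstIndex (p := fun n x => x ∉ P (n + 1))
      (fun n => (hl₁ x (hZ₃s hx.1) (n + 1)).not) ⟨p x, h2⟩
    rw [hPs] at h2
    have h3 : (T ^ e (p x)) x ∈ Q (p x) := by
      by_contra h; exact h2 ⟨h1, h⟩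
    have h4 : (T ^ e (p x)) x ∉ Q (p x + 1) := by
      rw [hQs]
      exact fun h => h.2 (by rw [mem_preimage, zpow_neg_apply_zpow]; exact h1)
    refine ⟨PowAt.dep (F := fun n x => (T ^ e n) x) hlc (PowAt.zpow T _ x),
      hQanti (Nat.zero_le _) h3, ?_⟩
    simp only
    rw [hqeq _ _ h3 h4, zpow_neg_apply_zpow]
  · intro x hx hxB
    obtain ⟨h1, h2⟩ := hqQ x hxB (hl₄ x hx.2)
    have hlc : LCAt q x := LCAt.firstIndex (p := fun n x => x ∉ Q (n + 1))
      (fun n => (hl₂ x (hZ₄s hx.2) (n + 1)).not) ⟨q x, h2⟩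
    rw [hQs] at h2
    have h3 : (T ^ (-e (q x))) x ∈ P (q x) := by
      by_contra h; exact h2 ⟨h1, h⟩
    have h4 : (T ^ (-e (q x))) x ∉ P (q x + 1) := by
      rw [hPs]
      exact fun h => h.2 (by rw [mem_preimage, zpow_apply_zpow_neg]; exact h1)
    refine ⟨PowAt.dep (F := fun n x => (T ^ (-e n)) x) hlc (PowAt.zpow T _ x),
      hPanti (Nat.zero_le _) h3, ?_⟩
    simp only
    rw [hpeq _ _ h3 h4, zpow_apply_zpow_neg]

end Ergodic

/-! ### Arrays of sets identified along orbits -/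

section Array

variable {X : Type u} [TopologicalSpace X] {ι κ τ : Type*} {T : X ≃ₜ X}

/-- A system of matrix units on `B`, on the points of a core `Z`: `B` is divided into pieces
`{ℓ = i}`, `i ∈ I`, and the maps `θ i : B → {ℓ = i}`, locally powers of `T`, identify any two
pieces compatibly. The equivalence relation it describes is `θ i x = θ i y` (for one, equivalently
all, `i ∈ I`). Values of `ℓ` and `θ` outside `Z ∩ B` are irrelevant. -/
structure IsArray (T : X ≃ₜ X) (Z B : Set X) (I : Set ι) (ℓ : X → ι) (θ : ι → X → X) : Prop where
  label_mem : ∀ x ∈ Z, x ∈ B → ℓ x ∈ I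
  lcAt_label : ∀ x ∈ Z, x ∈ B → LCAt ℓ x
  powAt : ∀ i ∈ I, ∀ x ∈ Z, x ∈ B → PowAt T (θ i) x
  mem : ∀ i ∈ I, ∀ x ∈ Z, x ∈ B → θ i x ∈ B
  label : ∀ i ∈ I, ∀ x ∈ Z, x ∈ B → ℓ (θ i x) = i
  trans : ∀ i ∈ I, ∀ j ∈ I, ∀ x ∈ Z, x ∈ B → θ j (θ i x) = θ j x
  self : ∀ x ∈ Z, x ∈ B → θ (ℓ x) x = x

theorem IsArray.relabel {Z B : Set X} {I : Set ι} {ℓ : X → ι} {θ : ι → X → X}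
    (h : IsArray T Z B I ℓ θ) {J : Set κ} {f : ι → κ} {g : κ → ι}
    (hf : ∀ i ∈ I, f i ∈ J ∧ g (f i) = i) (hg : ∀ k ∈ J, g k ∈ I ∧ f (g k) = k) :
    IsArray T Z B J (fun x => f (ℓ x)) (fun k => θ (g k)) where
  label_mem x hx hxB := (hf _ (h.label_mem x hx hxB)).1
  lcAt_label x hx hxB := (h.lcAt_label x hx hxB).comp f
  powAt k hk x hx hxB := h.powAt _ (hg k hk).1 x hx hxB
  mem k hk x hx hxB := h.mem _ (hg k hk).1 x hx hxB
  label k hk x hx hxB := by rw [h.label _ (hg k hk).1 x hx hxB, (hg k hk).2]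
  trans i hi j hj x hx hxB := h.trans _ (hg i hi).1 _ (hg j hj).1 x hx hxB
  self x hx hxB := by rw [(hf _ (h.label_mem x hx hxB)).2, h.self x hx hxB]

/-- An array can be put together from chunks: the piece with label `p` is the image of the base
`C (ch p)` of its chunk under the power `T ^ (ex p)`, and the bases of the chunks are identified
through a common set `E` by maps `a c : E → C c` with inverses `b c`. -/
theorem IsArray.of_chunks [MeasurableSpace X] [BorelSpace X] {μ : Measure X} {Z B E : Set X}
    (hZ : IsCore T μ Z) {J : Set ι} {ℓ : X → ι} {ch : ι → τ} {ex : ι → ℤ} {C : τ → Set X}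
    {a b : τ → X → X}
    (hlc : ∀ x ∈ Z, x ∈ B → LCAt ℓ x)
    (h1 : ∀ x ∈ Z, x ∈ B → ℓ x ∈ J ∧ (T ^ (-ex (ℓ x))) x ∈ C (ch (ℓ x)))
    (h2 : ∀ p ∈ J, ∀ z ∈ Z, z ∈ C (ch p) → (T ^ ex p) z ∈ B ∧ ℓ ((T ^ ex p) z) = p)
    (ha : ∀ p ∈ J, ∀ x ∈ Z, x ∈ E →
      PowAt T (a (ch p)) x ∧ a (ch p) x ∈ C (ch p) ∧ b (ch p) (a (ch p) x) = x)
    (hb : ∀ p ∈ J, ∀ x ∈ Z, x ∈ C (ch p) →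
      PowAt T (b (ch p)) x ∧ b (ch p) x ∈ E ∧ a (ch p) (b (ch p) x) = x) :
    IsArray T Z B J ℓ
      (fun p x => (T ^ ex p) (a (ch p) (b (ch (ℓ x)) ((T ^ (-ex (ℓ x))) x)))) := by
  have hbase : ∀ x ∈ Z, x ∈ B → PowAt T (fun x => b (ch (ℓ x)) ((T ^ (-ex (ℓ x))) x)) x ∧
      b (ch (ℓ x)) ((T ^ (-ex (ℓ x))) x) ∈ E ∧ b (ch (ℓ x)) ((T ^ (-ex (ℓ x))) x) ∈ Z := by
    intro x hx hxB
    obtain ⟨hJ, hC⟩ := h1 x hx hxB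
    obtain ⟨h3, h4, -⟩ := hb _ hJ _ (hZ.zpow_mem _ hx) hC
    exact ⟨PowAt.dep (F := fun p x => b (ch p) ((T ^ (-ex p)) x)) (hlc x hx hxB)
      (PowAt.comp (g := b (ch (ℓ x))) h3 (PowAt.zpow T _ x)), h4,
      hZ.powAt_mem h3 (hZ.zpow_mem _ hx)⟩
  have hmain : ∀ p ∈ J, ∀ x ∈ Z, x ∈ B → ∀ y, y = b (ch (ℓ x)) ((T ^ (-ex (ℓ x))) x) →
      (T ^ ex p) (a (ch p) y) ∈ B ∧ ℓ ((T ^ ex p) (a (ch p) y)) = p ∧ b (ch p) (a (ch p) y) = y := by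
    rintro p hp x hx hxB y rfl
    obtain ⟨-, hE, hyZ⟩ := hbase x hx hxB
    obtain ⟨h3, h4, h5⟩ := ha p hp _ hyZ hE
    obtain ⟨h6, h7⟩ := h2 p hp _ (hZ.powAt_mem h3 hyZ) h4
    exact ⟨h6, h7, h5⟩
  refine ⟨fun x hx hxB => (h1 x hx hxB).1, hlc, ?_, ?_, ?_, ?_, ?_⟩
  · intro p hp x hx hxB
    obtain ⟨h3, hE, hyZ⟩ := hbase x hx hxB
    exact PowAt.comp (g := fun y => (T ^ ex p) y) (PowAt.zpow T _ _)
      (PowAt.comp (g := a (ch p)) (ha p hp _ hyZ hE).1 h3)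
  · exact fun p hp x hx hxB => (hmain p hp x hx hxB _ rfl).1
  · exact fun p hp x hx hxB => (hmain p hp x hx hxB _ rfl).2.1
  · intro p hp q hq x hx hxB
    obtain ⟨-, h4, h5⟩ := hmain p hp x hx hxB _ rfl
    rw [h4, zpow_neg_apply_zpow, h5]
  · intro x hx hxB
    obtain ⟨hJ, hC⟩ := h1 x hx hxB
    obtain ⟨-, -, h5⟩ := hb _ hJ _ (hZ.zpow_mem _ hx) hC
    rw [h5, zpow_apply_zpow_neg]

end Array

/-! ### Blocks between consecutive visits to a set -/

section Block

variable {X : Type u} [TopologicalSpace X] {T : X ≃ₜ X} {D : Set X}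

/-- The time elapsed since the last visit of the orbit of `x` to `D`. -/
noncomputable def lastVisit (T : X ≃ₜ X) (D : Set X) (x : X) : ℕ :=
  sInf {n : ℕ | (T ^ (-(n : ℤ))) x ∈ D}

/-- The point of `D` visited last by the orbit of `x`. -/
noncomputable def blockBase (T : X ≃ₜ X) (D : Set X) (x : X) : X :=
  (T ^ (-(lastVisit T D x : ℤ))) x

/-- The first positive time at which the orbit of `x` visits `D`. -/
noncomputable def returnTime (T : X ≃ₜ X) (D : Set X) (x : X) : ℕ :=
  sInf {n : ℕ | (T ^ ((n : ℤ) + 1)) x ∈ D} + 1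

theorem blockBase_mem {x : X} (hx : ∃ n : ℕ, (T ^ (-(n : ℤ))) x ∈ D) : blockBase T D x ∈ D :=
  Nat.sInf_mem (s := {n : ℕ | (T ^ (-(n : ℤ))) x ∈ D}) hx

theorem zpow_lastVisit_blockBase (T : X ≃ₜ X) (D : Set X) (x : X) :
    (T ^ (lastVisit T D x : ℤ)) (blockBase T D x) = x :=
  zpow_apply_zpow_neg T _ x

theorem lastVisit_zpow_of_notMem {x : X} (hx : ∃ n : ℕ, (T ^ (-(n : ℤ))) x ∈ D) {n : ℕ}
    (hn : ∀ j : ℕ, j < n → (T ^ ((j : ℤ) + 1)) x ∉ D) :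
    lastVisit T D ((T ^ (n : ℤ)) x) = lastVisit T D x + n := by
  have h1 : (T ^ (-(lastVisit T D x : ℤ))) x ∈ D := blockBase_mem hx
  refine le_antisymm (Nat.sInf_le ?_) (le_csInf ⟨lastVisit T D x + n, ?_⟩ ?_)
  · rw [mem_ofPred_eq, ← zpow_add_apply]
    convert h1 using 3
    push_cast; ring
  · rw [mem_ofPred_eq, ← zpow_add_apply]
    convert h1 using 3
    push_cast; ring
  · intro m hm
    rw [mem_ofPred_eq, ← zpow_add_apply] at hm
    rcases lt_or_ge m n with h | h
    · exfalso
      apply hn (n - 1 - m) (by omega)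
      convert hm using 3
      push_cast [Nat.cast_sub (show m ≤ n - 1 by omega), Nat.cast_sub (show 1 ≤ n by omega)]
      ring
    · have : lastVisit T D x ≤ m - n := Nat.sInf_le (by
        rw [mem_ofPred_eq]
        convert hm using 3
        push_cast [Nat.cast_sub h]
        ring)
      omega

theorem blockBase_zpow_of_notMem {x : X} (hx : ∃ n : ℕ, (T ^ (-(n : ℤ))) x ∈ D) {n : ℕ}
    (hn : ∀ j : ℕ, j < n → (T ^ ((j : ℤ) + 1)) x ∉ D) :
    blockBase T D ((T ^ (n : ℤ)) x) = blockBase T D x := by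
  unfold blockBase
  rw [lastVisit_zpow_of_notMem hx hn, ← zpow_add_apply]
  congr 2
  push_cast; ring

/-- Points of an orbit segment that avoids `D` lie in the same block. -/
theorem blockBase_zpow_eq {x : X} (hx : ∀ k : ℤ, ∃ n : ℕ, (T ^ (-(n : ℤ))) ((T ^ k) x) ∈ D) {L : ℕ}
    (hL : ∀ i : ℤ, i.natAbs ≤ L → (T ^ i) x ∉ D) {k : ℤ} (hk : k.natAbs ≤ L) :
    blockBase T D ((T ^ k) x) = blockBase T D x := by
  rcases le_total 0 k with h | h
  · lift k to ℕ using h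
    exact blockBase_zpow_of_notMem (hx 0) fun j hj => hL _ (by omega)
  · have h1 := blockBase_zpow_of_notMem (T := T) (D := D) (x := (T ^ k) x) (n := k.natAbs) (hx k)
      (fun j hj => by
        rw [← zpow_add_apply]
        exact hL _ (by omega))
    rw [← h1, ← zpow_add_apply]
    have : (k.natAbs : ℤ) + k = 0 := by omega
    rw [this]; rfl

theorem lastVisit_zpow_of_lt {z : X} (hz : z ∈ D) {i : ℕ} (hi : i < returnTime T D z) :
    lastVisit T D ((T ^ (i : ℤ)) z) = i := by
  have h0 : lastVisit T D z = 0 := Nat.sInf_eq_zero.2 (Or.inl hz)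
  rw [lastVisit_zpow_of_notMem ⟨0, hz⟩, h0, zero_add]
  intro j hj
  have h1 : j < sInf {n : ℕ | (T ^ ((n : ℤ) + 1)) z ∈ D} := by
    unfold returnTime at hi; omega
  exact Nat.notMem_of_lt_sInf h1

theorem blockBase_zpow_of_lt {z : X} (hz : z ∈ D) {i : ℕ} (hi : i < returnTime T D z) :
    blockBase T D ((T ^ (i : ℤ)) z) = z := by
  unfold blockBase
  rw [lastVisit_zpow_of_lt hz hi, zpow_neg_apply_zpow]

theorem lastVisit_lt_returnTime {x : X}
    (hf : ∃ n : ℕ, (T ^ ((n : ℤ) + 1)) (blockBase T D x) ∈ D) :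
    lastVisit T D x < returnTime T D (blockBase T D x) := by
  unfold returnTime
  rw [Nat.lt_succ_iff]
  refine le_csInf hf fun n hn => ?_
  by_contra hlt
  rw [mem_ofPred_eq, blockBase, ← zpow_add_apply] at hn
  have h1 := Nat.notMem_of_lt_sInf (show lastVisit T D x - (n + 1) < lastVisit T D x by omega)
  apply h1
  rw [mem_ofPred_eq]
  convert hn using 3
  push_cast [Nat.cast_sub (show n + 1 ≤ lastVisit T D x by omega)]
  ring

theorem lcAt_lastVisit {x : X} (hD : ∀ k : ℤ, LCAt (· ∈ D) ((T ^ k) x))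
    (hx : ∃ n : ℕ, (T ^ (-(n : ℤ))) x ∈ D) : LCAt (lastVisit T D) x :=
  LCAt.firstIndex (p := fun n x => (T ^ (-(n : ℤ))) x ∈ D)
    (fun _ => LCAt.comp_powAt (l := (· ∈ D)) (hD _) (PowAt.zpow T _ x)) hx

theorem powAt_blockBase {x : X} (hD : ∀ k : ℤ, LCAt (· ∈ D) ((T ^ k) x))
    (hx : ∃ n : ℕ, (T ^ (-(n : ℤ))) x ∈ D) : PowAt T (blockBase T D) x :=
  PowAt.dep (F := fun n x => (T ^ (-((n : ℕ) : ℤ))) x) (lcAt_lastVisit hD hx) (PowAt.zpow T _ x)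

theorem lcAt_returnTime {x : X} (hD : ∀ k : ℤ, LCAt (· ∈ D) ((T ^ k) x))
    (hx : ∃ n : ℕ, (T ^ ((n : ℤ) + 1)) x ∈ D) : LCAt (returnTime T D) x :=
  (LCAt.firstIndex (p := fun n x => (T ^ ((n : ℤ) + 1)) x ∈ D)
    (fun _ => LCAt.comp_powAt (l := (· ∈ D)) (hD _) (PowAt.zpow T _ x)) hx).comp (· + 1)

variable {ι : Type*}

/-- The list of the values of a labelling `Q` along the block based at `z ∈ D`. -/
noncomputable def blockName (T : X ≃ₜ X) (D : Set X) (Q : X → ι) (z : X) : List ι :=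
  List.ofFn fun i : Fin (returnTime T D z) => Q ((T ^ ((i : ℕ) : ℤ)) z)

theorem lcAt_blockName {Q : X → ι} {x : X} (hQ : ∀ k : ℤ, LCAt Q ((T ^ k) x))
    (hr : LCAt (returnTime T D) x) : LCAt (blockName T D Q) x :=
  LCAt.dep (F := fun n z => List.ofFn fun i : Fin n => Q ((T ^ ((i : ℕ) : ℤ)) z)) hr
    ((LCAt.pi fun i : Fin (returnTime T D x) =>
      LCAt.comp_powAt (l := Q) (hQ _) (PowAt.zpow T ((i : ℕ) : ℤ) x)).comp List.ofFn)

theorem length_blockName (Q : X → ι) (z : X) :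
    (blockName T D Q z).length = returnTime T D z := List.length_ofFn

theorem getElem?_blockName (Q : X → ι) {z : X} {i : ℕ} (hi : i < returnTime T D z) :
    (blockName T D Q z)[i]? = some (Q ((T ^ (i : ℤ)) z)) := by
  unfold blockName
  rw [List.getElem?_ofFn, dif_pos hi]

end Block

/-! ### Division into pieces of equal measure -/

section Cutting

variable {X : Type u} [TopologicalSpace X] [MeasurableSpace X] [BorelSpace X] {T : X ≃ₜ X}
  {μ : Measure X} {g : X → ℝ}

theorem exists_measure_diff_lt {B : Set X} (hB : NullMeasurableSet B μ) (hfin : μ B ≠ ⊤)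
    {V : ℕ → Set X} (hV : Monotone V) (hVm : ∀ n, NullMeasurableSet (V n) μ)
    (hcov : ∀ᵐ x ∂μ, x ∈ B → ∃ n, x ∈ V n) {ε : ℝ≥0∞} (hε : ε ≠ 0) : ∃ n, μ (B \ V n) < ε := by
  have h1 : μ (⋂ n, B \ V n) = 0 := by
    rw [measure_eq_zero_iff_ae_notMem]
    filter_upwards [hcov] with x hx hmem
    have h2 := mem_iInter.1 hmem
    obtain ⟨n, hn⟩ := hx (h2 0).1
    exact (h2 n).2 hn
  rw [Antitone.measure_iInter (fun i j hij => sdiff_subset_sdiff_right (hV hij))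
    (fun n => hB.diff (hVm n)) ⟨0, ne_top_of_le_ne_top hfin (measure_mono sdiff_subset)⟩] at h1
  exact iInf_lt_iff.1 (h1 ▸ pos_iff_ne_zero.2 hε)

open Classical in
/-- Cutting off `N` pieces of measure `η`: they are labelled `0, …, N - 1`. -/
theorem IsCoordinate.exists_equal_pieces (hg : IsCoordinate μ g) {η : ℝ≥0∞} (hη : η ≠ ⊤) (N : ℕ) :
    ∀ {A : Set X}, μ (frontier A) = 0 → N * η ≤ μ A →
      ∃ κ : X → ℕ, (∀ᵐ x ∂μ, LCAt κ x) ∧ (∀ j < N, μ (A ∩ {x | κ x = j}) = η) ∧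
        μ (A ∩ {x | N ≤ κ x}) + N * η = μ A := by
  induction N with
  | zero =>
    intro A _ _
    exact ⟨fun _ => 0, Eventually.of_forall fun x => LCAt.const 0 x, by simp, by simp⟩
  | succ N ih =>
    intro A hA hN
    have h1 : η ≤ μ A := le_trans (by
      rw [Nat.cast_succ, add_mul, one_mul]; exact le_add_self) hN
    obtain ⟨C, hCA, hC, hCη⟩ := hg.exists_subset_measure_eq hA h1
    have hsum : η + μ (A \ C) = μ A := by
      rw [← measure_inter_add_sdiff₀ A (nullMeasurableSet_of_null_frontier hC),
        inter_eq_self_of_subset_right hCA, hCη]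
    obtain ⟨κ, hκ, hκ1, hκ2⟩ := ih (null_frontier_diff hA hC) (by
      rw [← hsum, Nat.cast_succ, add_mul, one_mul, add_comm] at hN
      exact (ENNReal.add_le_add_iff_left hη).1 hN)
    refine ⟨fun x => if x ∈ C then 0 else κ x + 1, ?_, ?_, ?_⟩
    · filter_upwards [hκ, measure_eq_zero_iff_ae_notMem.1 hC] with x h2 h3
      exact ((lcAt_of_notMem_frontier h3).prodMk h2).comp
        (fun p : Prop × ℕ => if p.1 then 0 else p.2 + 1)
    · rintro (_ | j) hj
      · convert hCη using 2
        ext x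
        constructor
        · rintro ⟨_, h⟩
          by_contra hxC
          simp [hxC] at h
        · exact fun h => ⟨hCA h, by simp [h]⟩
      · rw [← hκ1 j (by omega)]
        congr 1
        ext x
        by_cases hxC : x ∈ C <;> simp [hxC]
    · rw [← hsum, ← hκ2]
      have : A ∩ {x | N + 1 ≤ if x ∈ C then 0 else κ x + 1} = A \ C ∩ {x | N ≤ κ x} := by
        ext x
        by_cases hxC : x ∈ C <;> simp [hxC]
      rw [this]
      push_cast
      ring

end Cutting

/-! ### Columns over a small recurrent set -/

section Step

variable {X : Type u} [TopologicalSpace X] [MeasurableSpace X] [BorelSpace X] {T : X ≃ₜ X}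
  {μ : Measure X} {g : X → ℝ}

/-- There are sets of arbitrarily small measure which the orbit of almost every point visits both in
the past and in the future, so that orbits are divided into finite blocks between the visits. -/
theorem IsCoordinate.exists_small_recurrent_set (hg : IsCoordinate μ g) (hT : Ergodic T μ)
    {B : Set X} (hB : μ (frontier B) = 0) (h0 : μ B ≠ 0) (hfin : μ B ≠ ⊤) {c : ℝ≥0∞}
    (hc : c ≠ 0) : ∃ D W : Set X, IsCore T μ W ∧ μ D ≤ c ∧ μ D ≠ ⊤ ∧
      ∀ x ∈ W, LCAt (· ∈ D) x ∧ (∃ n : ℕ, (T ^ (-(n : ℤ))) x ∈ D) ∧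
        ∃ n : ℕ, (T ^ ((n : ℤ) + 1)) x ∈ D := by
  have hmp := hT.toMeasurePreserving
  obtain ⟨D, hDB, hD, hDm⟩ := hg.exists_subset_measure_eq hB (min_le_right c (μ B))
  have hD0 : μ D ≠ 0 := by rw [hDm]; exact (lt_min (pos_iff_ne_zero.2 hc) (pos_iff_ne_zero.2 h0)).ne'
  have hDn := nullMeasurableSet_of_null_frontier hD
  obtain ⟨Z, hZ, hl⟩ := exists_isCore_lcAt_set (ι := Unit) hmp (fun _ => D) (fun _ => hD)
  have hlz : ∀ x ∈ Z, ∀ k : ℤ, LCAt (fun y => (T ^ k) y ∈ D) x := fun x hx k =>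
    LCAt.comp_powAt (l := (· ∈ D)) (hl _ (hZ.zpow_mem k hx) ()) (PowAt.zpow T k x)
  obtain ⟨Z₁, hZ₁s, hZ₁, h1⟩ := exists_isCore_of_ae_exists hmp hZ
    (fun (n : ℕ) x => (T ^ (-(n : ℤ))) x ∈ D) (fun x hx n => hlz x hx _)
    (hg.ae_exists_past_mem hT hDn hD0)
  obtain ⟨Z₂, hZ₂s, hZ₂, h2⟩ := exists_isCore_of_ae_exists hmp hZ
    (fun (n : ℕ) x => (T ^ ((n : ℤ) + 1)) x ∈ D) (fun x hx n => hlz x hx _)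
    (hg.ae_exists_future_mem hT hDn hD0)
  exact ⟨D, Z₁ ∩ Z₂, hZ₁.inter hZ₂, hDm.trans_le (min_le_left _ _),
    ne_top_of_le_ne_top hfin (measure_mono hDB),
    fun x hx => ⟨hl x (hZ₁s hx.1) (), h1 x hx.1, h2 x hx.2⟩⟩

theorem ENNReal.exists_nat_mul_le_lt {a η : ℝ≥0∞} (ha : a ≠ ⊤) (hη : η ≠ 0) :
    ∃ N : ℕ, N * η ≤ a ∧ a < (N + 1) * η := by
  classical
  have hex : ∃ n : ℕ, a < n * η := ENNReal.exists_nat_mul_gt hη ha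
  obtain ⟨N, hN⟩ : ∃ N, Nat.find hex = N + 1 := Nat.exists_eq_succ_of_ne_zero fun h => by
    have := Nat.find_spec hex
    rw [h] at this
    simp at this
  refine ⟨N, not_lt.1 (Nat.find_min hex (by omega)), ?_⟩
  have := Nat.find_spec hex
  rw [hN] at this
  exact_mod_cast this

open Classical in
/-- The set `D` is divided by a labelling `c` into countably many columns, the column of label `w`
having height at most `len w`. If `η` is small, pieces of measure exactly `η` of finitely many
columns suffice to cover all of `B` but a set of small measure. -/
theorem IsCoordinate.exists_column_pieces (hg : IsCoordinate μ g) (hT : MeasurePreserving T μ μ)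
    {W B D : Set X} (hW : IsCore T μ W) {γ : Type*} [Countable γ] {c : X → γ} {len : γ → ℕ}
    {s : X → ℕ} {β : X → X} (hB : NullMeasurableSet B μ) (hBfin : μ B ≠ ⊤) (hDfin : μ D ≠ ⊤)
    (hD : ∀ x ∈ W, LCAt (· ∈ D) x) (hc : ∀ x ∈ W, LCAt c x) (hβ : ∀ x ∈ W, PowAt T β x)
    (hβD : ∀ x ∈ W, β x ∈ D) (hβs : ∀ x, β x = (T ^ (-(s x : ℤ))) x)
    (hs : ∀ x ∈ W, s x < len (c (β x))) {ε : ℝ≥0∞} (hε : ε ≠ 0) :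
    ∃ δ : ℝ≥0∞, δ ≠ 0 ∧ ∀ η ≤ δ, η ≠ 0 → η ≠ ⊤ → ∃ (V : Set X) (κ : X → ℕ) (S : Finset (γ × ℕ)),
      IsCore T μ V ∧ (∀ x ∈ V, LCAt κ x) ∧ (∀ p ∈ S, μ (D ∩ {z | (c z, κ z) = p}) = η) ∧
      μ (B ∩ {x | (c (β x), κ (β x)) ∉ S}) ≤ ε := by
  obtain ⟨enc, henc⟩ := Countable.exists_injective_nat γ
  have hcβ : ∀ x ∈ W, LCAt (fun x => c (β x)) x := fun x hx =>
    LCAt.comp_powAt (hc _ (hW.powAt_mem (hβ x hx) hx)) (hβ x hx)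
  obtain ⟨n, hn⟩ := exists_measure_diff_lt (μ := μ) hB hBfin (V := fun n => {x | enc (c (β x)) < n})
    (fun i j hij x (hx : _ < i) => lt_of_lt_of_le hx hij)
    (fun n => hW.nullMeasurableSet fun x hx => (hcβ x hx).comp (fun w => enc w < n))
    (Eventually.of_forall fun x _ => ⟨_, Nat.lt_succ_self _⟩) (ENNReal.half_pos hε).ne'
  have hfinW : {w | enc w < n}.Finite := (finite_lt_nat n).preimage henc.injOn
  set C := hfinW.toFinset with hC
  have hCmem : ∀ w, w ∈ C ↔ enc w < n := fun w => by rw [hC, Set.Finite.mem_toFinset]; rfl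
  set M := ∑ w ∈ C, len w with hM
  -- All but finitely many columns are negligible on `B`. Each of the others loses less than one piece
  -- of measure `η` of its base, hence at most `len w * η` in all its levels together.
  refine ⟨ε / 2 / (M + 1), ?_, fun η hη hη0 hηt => ?_⟩
  · exact ENNReal.div_ne_zero.2 ⟨(ENNReal.half_pos hε).ne', by finiteness⟩
  have hcolf : ∀ w, μ (frontier (D ∩ {z | c z = w})) = 0 := fun w =>
    hW.frontier_null fun x hx => (hD x hx).and ((hc x hx).comp (fun a => a = w))
  have hcolt : ∀ w, μ (D ∩ {z | c z = w}) ≠ ⊤ := fun w =>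
    ne_top_of_le_ne_top hDfin (measure_mono inter_subset_left)
  choose N hN hN' using fun w => ENNReal.exists_nat_mul_le_lt (hcolt w) hη0
  choose K hK hK1 hK2 using fun w => hg.exists_equal_pieces hηt (N w) (hcolf w) (hN w)
  obtain ⟨V, hV, hVK⟩ := exists_isCore_lcAt hT K hK
  set S : Finset (γ × ℕ) := C.biUnion fun w => (Finset.range (N w)).image (Prod.mk w) with hS
  have hSmem : ∀ w j, (w, j) ∈ S ↔ w ∈ C ∧ j < N w := by
    intro w j
    simp [hS]
  refine ⟨W ∩ V, fun z => K (c z) z, S, hW.inter hV, fun x hx =>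
    LCAt.dep (F := K) (hc x hx.1) (hVK x hx.2 _), ?_, ?_⟩
  · rintro ⟨w, j⟩ hp
    rw [← hK1 w j ((hSmem w j).1 hp).2]
    congr 1
    ext z
    simp only [mem_inter_iff, mem_ofPred_eq, Prod.mk.injEq, and_assoc]
    refine and_congr_right fun _ => and_congr_right fun h => by rw [h]
  · have hleft : ∀ w, μ (D ∩ {z | c z = w} ∩ {z | N w ≤ K w z}) ≤ η := by
      intro w
      have h1 := hN' w
      rw [← hK2 w, add_mul, one_mul, add_comm] at h1
      exact ((ENNReal.add_lt_add_iff_left (by finiteness)).1 h1).le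
    have hsub : B ∩ {x | (c (β x), K (c (β x)) (β x)) ∉ S} ⊆ (B \ {x | enc (c (β x)) < n}) ∪
        (Wᶜ ∪ ⋃ w ∈ C, ⋃ i ∈ Finset.range (len w),
          (T ^ (-((i : ℕ) : ℤ)) : X ≃ₜ X) ⁻¹' (D ∩ {z | c z = w} ∩ {z | N w ≤ K w z})) := by
      rintro x ⟨hxB, hx⟩
      by_cases h1 : enc (c (β x)) < n
      · right
        by_cases hxW : x ∈ W
        · right
          refine mem_iUnion₂.2 ⟨c (β x), (hCmem _).2 h1, mem_iUnion₂.2 ⟨s x,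
            Finset.mem_range.2 (hs x hxW), ?_⟩⟩
          rw [mem_preimage, ← hβs]
          refine ⟨⟨hβD x hxW, rfl⟩, ?_⟩
          by_contra h2
          exact hx ((hSmem _ _).2 ⟨(hCmem _).2 h1, not_le.1 h2⟩)
        · exact Or.inl hxW
      · exact Or.inl ⟨hxB, h1⟩
    calc _ ≤ μ (B \ {x | enc (c (β x)) < n}) + (μ Wᶜ + μ (⋃ w ∈ C, ⋃ i ∈ Finset.range (len w),
          (T ^ (-((i : ℕ) : ℤ)) : X ≃ₜ X) ⁻¹' (D ∩ {z | c z = w} ∩ {z | N w ≤ K w z}))) :=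
          (measure_mono hsub).trans ((measure_union_le _ _).trans
            (add_le_add_right (measure_union_le _ _) _))
      _ ≤ ε / 2 + (0 + ∑ w ∈ C, ∑ i ∈ Finset.range (len w), η) := by
          refine add_le_add hn.le (add_le_add hW.null.le ?_)
          refine (measure_biUnion_finset_le _ _).trans (Finset.sum_le_sum fun w _ => ?_)
          refine (measure_biUnion_finset_le _ _).trans (Finset.sum_le_sum fun i _ => ?_)
          rw [measure_zpow_preimage hT]
          exact hleft w
      _ = ε / 2 + M * η := by
          simp only [Finset.sum_const, Finset.card_range, nsmul_eq_mul, zero_add]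
          rw [← Finset.sum_mul, hM, Nat.cast_sum]
      _ ≤ ε / 2 + ε / 2 := by
          gcongr
          calc (M : ℝ≥0∞) * η ≤ (M + 1) * (ε / 2 / (M + 1)) := by
                gcongr
                exact le_self_add
            _ ≤ ε / 2 := ENNReal.mul_div_le
      _ = ε := ENNReal.add_halves ε

end Step

/-! ### Arrays that capture most of the orbit relation -/

section Refinement

variable {X : Type u} [TopologicalSpace X] [MeasurableSpace X] [BorelSpace X] {T : X ≃ₜ X}
  {μ : Measure X} {g : X → ℝ}

open Classical in
theorem LCAt.extend_none {ι : Type*} {B : Set X} {Q : X → ι} {x : X} (hB : LCAt (· ∈ B) x)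
    (hQ : x ∈ B → LCAt Q x) : LCAt (fun y => if y ∈ B then some (Q y) else none) x := by
  by_cases hx : x ∈ B
  · exact (hB.prodMk (hQ hx)).comp (fun p : Prop × ι => if p.1 then some p.2 else none)
  · filter_upwards [hB] with y hy
    simp only [hy, hx, if_false]

open Classical in
/-- The refinement step. For all large `m` there is an array on `B` with `m` pieces for which, up to
a set of small measure, the pieces respect the labelling `Q` and the orbit connections `f a` between
points of `B` lie in the equivalence relation of the array. The equivalence classes are essentially
the blocks between consecutive visits to a small recurrent set `D`, and the columns over `D`
according to the name of a block are cut into pieces of the same measure. -/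
theorem IsCoordinate.exists_isArray (hg : IsCoordinate μ g) (hT : Ergodic T μ) {Z B : Set X}
    (hZ : IsCore T μ Z) (hB : ∀ x ∈ Z, LCAt (· ∈ B) x) (h0 : μ B ≠ 0) (hfin : μ B ≠ ⊤)
    {ι : Type*} [Countable ι] {Q : X → ι} (hQ : ∀ x ∈ Z, x ∈ B → LCAt Q x)
    {F : Type*} [Finite F] {f : F → X → X}
    (hf : ∀ a, ∀ x ∈ Z, x ∈ B → PowAt T (f a) x ∧ f a x ∈ B) {ε : ℝ≥0∞} (hε : ε ≠ 0) :
    ∃ k₀ : ℕ, k₀ ≠ 0 ∧ ∀ m ≥ k₀, ∃ (W : Set X) (r : X → ℕ) (ρ : ℕ → X → X) (O : Set X),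
      W ⊆ Z ∧ IsCore T μ W ∧ IsArray T W B {v | v < m} r ρ ∧ IsOpen O ∧ μ (B \ O) ≤ ε ∧
      ∀ y ∈ O, y ∈ W → y ∈ B →
        (∀ y' ∈ W, y' ∈ B → r y' = r y → Q y' = Q y) ∧ ∀ a, ρ 0 (f a y) = ρ 0 y := by
  have hmp := hT.toMeasurePreserving
  have hBf : μ (frontier B) = 0 := hZ.frontier_null hB
  have hBn : NullMeasurableSet B μ := nullMeasurableSet_of_null_frontier hBf
  have hε3 : ε / 3 ≠ 0 := ENNReal.div_ne_zero.2 ⟨hε, by finiteness⟩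
  -- Outside a set of measure less than `ε / 3` the exponents of the connections `f a` are bounded by
  -- some `L`.
  set V : ℕ → Set X := fun n => {x | ∀ a, ∃ k : ℤ, k.natAbs ≤ n ∧ ∀ᶠ y in 𝓝 x, f a y = (T ^ k) y}
    with hV
  have hVo : ∀ n, IsOpen (V n) := by
    intro n
    rw [isOpen_iff_mem_nhds]
    intro x hx
    refine eventually_all.2 fun a => ?_
    obtain ⟨k, hk, hk'⟩ := hx a
    filter_upwards [eventually_eventually_nhds.2 hk'] with y hy
    exact ⟨k, hk, hy⟩
  obtain ⟨L, hL⟩ := exists_measure_diff_lt (V := V) hBn hfin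
    (fun i j hij x hx a => (hx a).imp fun k hk => ⟨hk.1.trans hij, hk.2⟩)
    (fun n => (hVo n).measurableSet.nullMeasurableSet) (by
      filter_upwards [hZ.ae_mem] with x hx hxB
      choose k hk using fun a => (hf a x hx hxB).1
      cases nonempty_fintype F
      refine ⟨∑ a, (k a).natAbs, fun a => ⟨k a, ?_, hk a⟩⟩
      exact Finset.single_le_sum (f := fun a => (k a).natAbs) (fun _ _ => Nat.zero_le _)
        (Finset.mem_univ a)) hε3
  -- The set `D` is so small that the orbits of most points avoid it from time `-L` to time `L`.
  obtain ⟨D, W₁, hW₁, hDc, hDt, hDW⟩ := hg.exists_small_recurrent_set hT hBf h0 hfin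
    (c := ε / 3 / (2 * L + 1)) (ENNReal.div_ne_zero.2 ⟨hε3, by finiteness⟩)
  set Qt : X → Option ι := fun y => if y ∈ B then some (Q y) else none with hQt
  have hQtlc : ∀ x ∈ Z, LCAt Qt x := fun x hx => LCAt.extend_none (hB x hx) (hQ x hx)
  set W := Z ∩ W₁ with hWdef
  have hW : IsCore T μ W := hZ.inter hW₁
  -- `x` is the `s x`-th point of the block based at `β x`, and `c (β x)` is the name of the block.
  set β := blockBase T D with hβdef
  set s := lastVisit T D with hsdef
  set c := blockName T D Qt with hcdef
  have hDl : ∀ x ∈ W, ∀ k : ℤ, LCAt (· ∈ D) ((T ^ k) x) := fun x hx k =>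
    (hDW _ (hW₁.zpow_mem k hx.2)).1
  have hpast : ∀ x ∈ W, ∀ k : ℤ, ∃ n : ℕ, (T ^ (-(n : ℤ))) ((T ^ k) x) ∈ D := fun x hx k =>
    (hDW _ (hW₁.zpow_mem k hx.2)).2.1
  have hslc : ∀ x ∈ W, LCAt s x := fun x hx => lcAt_lastVisit (hDl x hx) (hpast x hx 0)
  have hβp : ∀ x ∈ W, PowAt T β x := fun x hx => powAt_blockBase (hDl x hx) (hpast x hx 0)
  have hβW : ∀ x ∈ W, β x ∈ W := fun x hx => hW.powAt_mem (hβp x hx) hx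
  have hβD : ∀ x ∈ W, β x ∈ D := fun x hx => blockBase_mem (hpast x hx 0)
  have hslt : ∀ x ∈ W, s x < returnTime T D (β x) := fun x hx =>
    lastVisit_lt_returnTime (hDW _ (hβW x hx).2).2.2
  have hclc : ∀ x ∈ W, LCAt c x := fun x hx =>
    lcAt_blockName (fun k => hQtlc _ (hZ.zpow_mem k hx.1))
      (lcAt_returnTime (hDl x hx) (hDW x hx.2).2.2)
  have hcs : ∀ x ∈ W, (c (β x))[s x]? = some (Qt x) := by
    intro x hx
    rw [hcdef, getElem?_blockName Qt (hslt x hx), hβdef, hsdef, zpow_lastVisit_blockBase]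
  obtain ⟨δ, hδ0, hδ⟩ := hg.exists_column_pieces hmp hW (len := List.length) hBn hfin hDt
    (fun x hx => (hDW x hx.2).1) hclc hβp hβD (s := s) (fun x => rfl)
    (fun x hx => by rw [hcdef, length_blockName]; exact hslt x hx) hε3
  obtain ⟨k₀, hk₀⟩ := ENNReal.exists_nat_mul_gt hδ0 hfin
  have hk₀0 : k₀ ≠ 0 := by rintro rfl; simp at hk₀
  refine ⟨k₀, hk₀0, fun m hm => ?_⟩
  have hm0 : m ≠ 0 := by omega
  have hm0' : (m : ℝ≥0∞) ≠ 0 := by exact_mod_cast hm0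
  set η := μ B / m with hη
  have hmη : (m : ℝ≥0∞) * η = μ B := ENNReal.mul_div_cancel hm0' (by finiteness)
  have hη0 : η ≠ 0 := ENNReal.div_ne_zero.2 ⟨h0, by finiteness⟩
  have hηt : η ≠ ⊤ := ENNReal.div_ne_top hfin hm0'
  have hηδ : η ≤ δ := by
    refine ENNReal.div_le_of_le_mul (hk₀.le.trans ?_)
    rw [mul_comm]
    gcongr
  obtain ⟨V₁, κ, S, hV₁, hκlc, hS, hleft⟩ := hδ η hηδ hη0 hηt
  -- `st x` tells to which piece of which column the base of the block of `x` belongs.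
  set st : X → List (Option ι) × ℕ := fun x => (c (β x), κ (β x)) with hst
  have hW₂ : IsCore T μ (W ∩ V₁) := hW.inter hV₁
  have hstlc : ∀ x ∈ W ∩ V₁, LCAt st x := fun x hx =>
    (LCAt.comp_powAt (hclc _ (hβW x hx.1)) (hβp x hx.1)).prodMk
      (LCAt.comp_powAt (hκlc _ (hV₁.powAt_mem (hβp x hx.1) hx.2)) (hβp x hx.1))
  -- The levels of the columns over the selected pieces, as far as they lie in `B`; a level lies either
  -- inside or outside `B`, because the name of the block records it.
  set J₁ : Finset ((List (Option ι) × ℕ) × ℕ) := S.biUnion fun p =>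
    ((Finset.range p.1.length).filter fun i => ∃ q, p.1[i]? = some (some q)).image (Prod.mk p)
    with hJ₁
  have hJ₁mem : ∀ p i, (p, i) ∈ J₁ ↔ p ∈ S ∧ ∃ q, p.1[i]? = some (some q) := by
    intro p i
    simp only [hJ₁, Finset.mem_biUnion, Finset.mem_image, Finset.mem_filter, Finset.mem_range,
      Prod.mk.injEq]
    constructor
    · rintro ⟨p', hp', i', ⟨-, hi'⟩, rfl, rfl⟩
      exact ⟨hp', hi'⟩
    · rintro ⟨hp, q, hq⟩
      exact ⟨p, hp, i, ⟨(List.getElem?_eq_some_iff.1 hq).1, q, hq⟩, rfl, rfl⟩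
  have hlev : ∀ p i, (p, i) ∈ J₁ → ∀ z ∈ W, z ∈ D → (c z, κ z) = p →
      (T ^ (i : ℤ)) z ∈ B ∧ st ((T ^ (i : ℤ)) z) = p ∧ s ((T ^ (i : ℤ)) z) = i := by
    intro p i hp z hz hzD hzp
    obtain ⟨hpS, q, hq⟩ := (hJ₁mem p i).1 hp
    have h1 : (c z)[i]? = some (some q) := by rw [show c z = p.1 from congrArg Prod.fst hzp]; exact hq
    have hi : i < returnTime T D z := by
      have := (List.getElem?_eq_some_iff.1 h1).1
      rwa [hcdef, length_blockName] at this
    have hb : β ((T ^ (i : ℤ)) z) = z := blockBase_zpow_of_lt hzD hi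
    refine ⟨?_, by simp only [hst, hb, hzp], lastVisit_zpow_of_lt hzD hi⟩
    rw [hcdef, getElem?_blockName Qt hi, Option.some_inj] at h1
    by_contra hnB
    simp only [hQt, if_neg hnB, reduceCtorEq] at h1
  have hJ₁of : ∀ x ∈ W, x ∈ B → st x ∈ S → (st x, s x) ∈ J₁ := by
    intro x hx hxB hxS
    refine (hJ₁mem _ _).2 ⟨hxS, Q x, ?_⟩
    have := hcs x hx
    simp only [hQt, if_pos hxB] at this
    exact this
  have hpiece : ∀ q ∈ J₁, μ (B ∩ {x | (st x, s x) = q}) = η := by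
    rintro ⟨p, i⟩ hq
    rw [← hS p ((hJ₁mem p i).1 hq).1, ← measure_zpow_preimage hmp (-(i : ℤ)) (D ∩ _)]
    apply measure_congr
    filter_upwards [hW.ae_mem] with x hx
    refine propext ⟨?_, ?_⟩
    · rintro ⟨hxB, h⟩
      obtain ⟨rfl, rfl⟩ := Prod.mk.inj h
      exact ⟨hβD x hx, rfl⟩
    · rintro ⟨h1, h2⟩
      have := hlev p i hq _ (hW.zpow_mem _ hx) h1 h2
      rw [zpow_apply_zpow_neg] at this
      exact ⟨this.1, Prod.ext this.2.1 this.2.2⟩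
  have hqlc : ∀ x ∈ W ∩ V₁, LCAt (fun x => (st x, s x)) x := fun x hx =>
    (hstlc x hx).prodMk (hslc x hx.1)
  set R : Set X := B ∩ {x | st x ∉ S} with hR
  have hRlc : ∀ x ∈ W ∩ V₁, LCAt (· ∈ R) x := fun x hx =>
    (hB x hx.1.1).and ((hstlc x hx).comp (fun p => p ∉ S))
  have hcount : μ R + J₁.card * η = μ B := by
    have h1 : μ (B ∩ {x | st x ∈ S}) = J₁.card * η := by
      have : μ (B ∩ {x | st x ∈ S}) = μ (⋃ q ∈ J₁, B ∩ {x | (st x, s x) = q}) := by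
        apply measure_congr
        filter_upwards [hW.ae_mem] with x hx
        refine propext ⟨fun h => mem_iUnion₂.2 ⟨_, hJ₁of x hx h.1 h.2, h.1, rfl⟩, fun h => ?_⟩
        obtain ⟨⟨p, i⟩, hq, hxB, h⟩ := mem_iUnion₂.1 h
        obtain ⟨rfl, rfl⟩ := Prod.mk.inj h
        exact ⟨hxB, ((hJ₁mem _ _).1 hq).1⟩
      rw [this, measure_biUnion_finset₀, Finset.sum_congr rfl hpiece, Finset.sum_const,
        nsmul_eq_mul]
      · intro q _ q' _ hqq'
        refine Disjoint.aedisjoint (Set.disjoint_left.2 fun x hx hx' => hqq' ?_)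
        exact (show _ = q from hx.2).symm.trans hx'.2
      · exact fun q _ => hW₂.nullMeasurableSet fun x hx =>
          (hB x hx.1.1).and ((hqlc x hx).comp (fun a => a = q))
    rw [← h1, add_comm, ← measure_inter_add_sdiff₀ B (t := {x | st x ∈ S})
      (hW₂.nullMeasurableSet fun x hx => (hstlc x hx).comp (fun p => p ∈ S))]
    rfl
  have hcard : J₁.card ≤ m := by
    have h1 : (J₁.card : ℝ≥0∞) * η ≤ m * η := by rw [hmη, ← hcount]; exact le_add_self
    exact_mod_cast (ENNReal.mul_le_mul_iff_left hη0 hηt).1 h1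
  set N := m - J₁.card with hN
  have hRN : (N : ℝ≥0∞) * η = μ R := by
    have h1 : (N : ℝ≥0∞) * η + J₁.card * η = μ R + J₁.card * η := by
      rw [hcount, ← hmη, ← add_mul, ← Nat.cast_add, hN, Nat.sub_add_cancel hcard]
    exact (ENNReal.add_left_inj (by finiteness)).1 h1
  -- The rest `R` of `B` is cut into pieces of the same measure; no part is left over, because the
  -- pieces have measure `μ B / m`.
  have hRf : μ (frontier R) = 0 := hW₂.frontier_null hRlc
  have hRt : μ R ≠ ⊤ := ne_top_of_le_ne_top hfin (measure_mono inter_subset_left)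
  obtain ⟨κ', hκ'ae, hκ'1, hκ'2⟩ := hg.exists_equal_pieces hηt N hRf hRN.le
  have hκ'0 : μ (R ∩ {x | N ≤ κ' x}) = 0 := by
    rw [hRN] at hκ'2
    nth_rewrite 2 [← zero_add (μ R)] at hκ'2
    exact (ENNReal.add_left_inj hRt).1 hκ'2
  obtain ⟨V₂, hV₂, hκ'lc⟩ := exists_isCore_lcAt_one hmp κ' hκ'ae
  obtain ⟨V₃, hV₃s, hV₃, hκ'lt⟩ := exists_isCore_of_ae_exists (ι := Unit) hmp (hW₂.inter hV₂)
    (fun _ x => x ∈ R → κ' x < N)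
    (fun x hx _ => ((hRlc x hx.1).prodMk (hκ'lc x hx.2)).comp
      (fun p : Prop × ℕ => p.1 → p.2 < N)) (by
      filter_upwards [measure_eq_zero_iff_ae_notMem.1 hκ'0] with x hx
      exact ⟨(), fun hxR => not_le.1 fun h => hx ⟨hxR, h⟩⟩)
  -- All pieces are linked to one reference set `E`.
  obtain ⟨E, hEB, hEf, hEη⟩ := hg.exists_subset_measure_eq hBf (c := η)
    (ENNReal.div_le_of_le_mul (le_mul_of_one_le_right' (by exact_mod_cast Nat.one_le_iff_ne_zero.2 hm0)))
  set C : (List (Option ι) × ℕ) ⊕ ℕ → Set X :=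
    Sum.elim (fun p => D ∩ {z | (c z, κ z) = p}) (fun j => R ∩ {x | κ' x = j}) with hC
  have hCf : ∀ t, μ (frontier (C t)) = 0 := by
    rintro (p | j)
    · exact hW₂.frontier_null fun x hx => (hDl x hx.1 0).and
        (((hclc x hx.1).prodMk (hκlc x hx.2)).comp (fun a => a = p))
    · exact (hW₂.inter hV₂).frontier_null fun x hx => (hRlc x hx.1).and
        ((hκ'lc x hx.2).comp (fun a => a = j))
  have hhopf : ∀ t, ∃ (Y : Set X) (a b : X → X), IsCore T μ Y ∧ (μ (C t) = η →
      (∀ x ∈ Y, x ∈ E → PowAt T a x ∧ a x ∈ C t ∧ b (a x) = x) ∧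
      (∀ x ∈ Y, x ∈ C t → PowAt T b x ∧ b x ∈ E ∧ a (b x) = x)) := by
    intro t
    by_cases ht : μ (C t) = η
    · obtain ⟨Y, a, b, hY, h1, h2⟩ := exists_hopf_equivalence hT hEf (hCf t) (hEη.trans ht.symm)
        (by rw [hEη]; exact hηt)
      exact ⟨Y, a, b, hY, fun _ => ⟨h1, h2⟩⟩
    · exact ⟨univ, id, id, IsCore.univ T μ, fun h => absurd h ht⟩
  choose Y a b hY hab using hhopf
  set W₃ : Set X := V₃ ∩ ⋂ t, Y t with hW₃def
  have hW₃ : IsCore T μ W₃ := hV₃.inter (IsCore.iInter hY)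
  have hW₃W : ∀ x ∈ W₃, x ∈ W := fun x hx => (hV₃s hx.1).1.1
  have hW₃V : ∀ x ∈ W₃, x ∈ W ∩ V₁ := fun x hx => (hV₃s hx.1).1
  set J : Finset (((List (Option ι) × ℕ) × ℕ) ⊕ ℕ) := J₁.disjSum (Finset.range N) with hJ
  have hJcard : J.card = m := by
    rw [hJ, Finset.card_disjSum, Finset.card_range, hN]; omega
  set ℓ : X → ((List (Option ι) × ℕ) × ℕ) ⊕ ℕ := fun x =>
    if st x ∈ S then Sum.inl (st x, s x) else Sum.inr (κ' x) with hℓ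
  set ch : ((List (Option ι) × ℕ) × ℕ) ⊕ ℕ → (List (Option ι) × ℕ) ⊕ ℕ := Sum.map Prod.fst id
    with hch
  set ex : ((List (Option ι) × ℕ) × ℕ) ⊕ ℕ → ℤ := Sum.elim (fun q => (q.2 : ℤ)) (fun _ => 0)
    with hex
  have hCη : ∀ p ∈ J, μ (C (ch p)) = η := by
    rintro (⟨p, i⟩ | j) hp
    · exact hS p ((hJ₁mem p i).1 (Finset.inl_mem_disjSum.1 hp)).1
    · exact hκ'1 j (Finset.mem_range.1 (Finset.inr_mem_disjSum.1 hp))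
  have harr : IsArray T W₃ B (J : Set (((List (Option ι) × ℕ) × ℕ) ⊕ ℕ)) ℓ
      (fun p x => (T ^ ex p) (a (ch p) (b (ch (ℓ x)) ((T ^ (-ex (ℓ x))) x)))) := by
    refine IsArray.of_chunks (E := E) (C := C) (a := a) (b := b) hW₃ ?_ ?_ ?_ ?_ ?_
    · intro x hx hxB
      exact ((hqlc x (hW₃V x hx)).prodMk (hκ'lc x (hV₃s hx.1).2)).comp
        (fun q : ((List (Option ι) × ℕ) × ℕ) × ℕ =>
          if q.1.1 ∈ S then (Sum.inl q.1 : ((List (Option ι) × ℕ) × ℕ) ⊕ ℕ) else Sum.inr q.2)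
    · intro x hx hxB
      by_cases hxS : st x ∈ S
      · have hx' : ℓ x = Sum.inl (st x, s x) := if_pos hxS
        rw [hx']
        exact ⟨Finset.inl_mem_disjSum.2 (hJ₁of x (hW₃W x hx) hxB hxS),
          hβD x (hW₃W x hx), rfl⟩
      · have hx' : ℓ x = Sum.inr (κ' x) := if_neg hxS
        rw [hx']
        obtain ⟨-, h⟩ := hκ'lt x hx.1
        exact ⟨Finset.inr_mem_disjSum.2 (Finset.mem_range.2 (h ⟨hxB, hxS⟩)), ⟨hxB, hxS⟩, rfl⟩
    · rintro (⟨p, i⟩ | j) hp z hz hzC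
      · have hp' := Finset.inl_mem_disjSum.1 hp
        obtain ⟨h1, h2, h3⟩ := hlev p i hp' z (hW₃W z hz) hzC.1 hzC.2
        refine ⟨h1, ?_⟩
        change ℓ ((T ^ (i : ℤ)) z) = _
        simp only [hℓ, h2, h3, if_pos ((hJ₁mem p i).1 hp').1]
      · refine ⟨hzC.1.1, ?_⟩
        change ℓ z = _
        simp only [hℓ, if_neg (show st z ∉ S from hzC.1.2)]
        rw [show κ' z = j from hzC.2]
    · exact fun p hp x hx => (hab (ch p) (hCη p hp)).1 x (mem_iInter.1 hx.2 _)
    · exact fun p hp x hx => (hab (ch p) (hCη p hp)).2 x (mem_iInter.1 hx.2 _)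
  -- The pieces are numbered by `0, …, m - 1`.
  set e : J ≃ Fin m := J.equivFinOfCardEq hJcard with he
  set num : ((List (Option ι) × ℕ) × ℕ) ⊕ ℕ → ℕ := fun p => if h : p ∈ J then e ⟨p, h⟩ else 0
    with hnum
  set ofNum : ℕ → ((List (Option ι) × ℕ) × ℕ) ⊕ ℕ := fun k =>
    if h : k < m then e.symm ⟨k, h⟩ else Sum.inr 0 with hofNum
  have hnum1 : ∀ p ∈ (J : Set (((List (Option ι) × ℕ) × ℕ) ⊕ ℕ)),
      num p ∈ {v | v < m} ∧ ofNum (num p) = p := by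
    intro p hp
    have h1 : num p = e ⟨p, hp⟩ := dif_pos hp
    rw [h1]
    refine ⟨(e ⟨p, hp⟩).2, ?_⟩
    simp only [hofNum]
    rw [dif_pos (e ⟨p, hp⟩).2]
    simp
  have hnum2 : ∀ k ∈ {v | v < m}, ofNum k ∈ (J : Set (((List (Option ι) × ℕ) × ℕ) ⊕ ℕ)) ∧
      num (ofNum k) = k := by
    intro k hk
    have h1 : ofNum k = e.symm ⟨k, hk⟩ := dif_pos hk
    rw [h1]
    refine ⟨(e.symm ⟨k, hk⟩).2, ?_⟩
    simp only [hnum]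
    rw [dif_pos (e.symm ⟨k, hk⟩).2]
    simp
  have harr' := harr.relabel hnum1 hnum2
  -- On `O` the exponents are bounded by `L`, and `D` is not visited within `L` steps, so that the
  -- connections `f a` stay in the block.
  set O : Set X := V L ∩ interior {y | (∀ i : Fin (2 * L + 1), (T ^ ((i : ℕ) - (L : ℤ))) y ∉ D) ∧
    st y ∈ S} with hO
  refine ⟨W₃, _, _, O, fun x hx => (hW₃W x hx).1, hW₃, harr',
    (hVo L).inter isOpen_interior, ?_, ?_⟩
  · have hsub : B \ O ⊆ (B \ V L) ∪ (W₃ᶜ ∪ ((⋃ i ∈ Finset.range (2 * L + 1),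
        (T ^ ((i : ℕ) - (L : ℤ)) : X ≃ₜ X) ⁻¹' D) ∪ R)) := by
      rintro x ⟨hxB, hxO⟩
      by_cases hxL : x ∈ V L
      swap
      · exact Or.inl ⟨hxB, hxL⟩
      right
      by_cases hxW : x ∈ W₃
      swap
      · exact Or.inl hxW
      right
      by_contra hcon
      rw [mem_union, not_or] at hcon
      refine hxO ⟨hxL, LCAt.mem_interior (p := fun y =>
        (∀ i : Fin (2 * L + 1), (T ^ ((i : ℕ) - (L : ℤ))) y ∉ D) ∧ st y ∈ S) ?_ ⟨fun i hi => ?_, ?_⟩⟩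
      · refine LCAt.and (LCAt.forall_finite fun i => ?_)
          ((hstlc x (hW₃V x hxW)).comp (fun p => p ∈ S))
        exact (LCAt.comp_powAt (l := (· ∈ D)) (hDl x (hW₃W x hxW) _) (PowAt.zpow T _ x)).not
      · exact hcon.1 (mem_iUnion₂.2 ⟨i, Finset.mem_range.2 i.2, hi⟩)
      · by_contra h
        exact hcon.2 ⟨hxB, h⟩
    calc μ (B \ O) ≤ μ (B \ V L) + (μ W₃ᶜ + (μ (⋃ i ∈ Finset.range (2 * L + 1),
        (T ^ ((i : ℕ) - (L : ℤ)) : X ≃ₜ X) ⁻¹' D) + μ R)) :=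
          (measure_mono hsub).trans ((measure_union_le _ _).trans
            (add_le_add_right ((measure_union_le _ _).trans
              (add_le_add_right (measure_union_le _ _) _)) _))
      _ ≤ ε / 3 + (0 + (∑ i ∈ Finset.range (2 * L + 1), μ D + ε / 3)) := by
          refine add_le_add hL.le (add_le_add hW₃.null.le (add_le_add ?_ hleft))
          refine (measure_biUnion_finset_le _ _).trans (Finset.sum_le_sum fun i _ => ?_)
          rw [measure_zpow_preimage hmp]
      _ ≤ ε / 3 + (0 + (ε / 3 + ε / 3)) := by
          gcongr
          rw [Finset.sum_const, Finset.card_range, nsmul_eq_mul]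
          calc ((2 * L + 1 : ℕ) : ℝ≥0∞) * μ D ≤ (2 * L + 1) * (ε / 3 / (2 * L + 1)) := by
                push_cast
                gcongr
            _ ≤ ε / 3 := ENNReal.mul_div_le
      _ = ε := by rw [zero_add, ← add_assoc, ENNReal.add_thirds]
  · intro y hyO hyW hyB
    obtain ⟨hyL, hyI⟩ := hyO
    obtain ⟨hyD, hyS⟩ := interior_subset hyI
    have hℓy : ℓ y = Sum.inl (st y, s y) := if_pos hyS
    refine ⟨fun y' hy' hy'B hr => ?_, fun i => ?_⟩
    · have h1 : ℓ y' = ℓ y := by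
        rw [← (hnum1 _ (harr.label_mem y' hy' hy'B)).2, ← (hnum1 _ (harr.label_mem y hyW hyB)).2]
        exact congrArg ofNum hr
      have hy'S : st y' ∈ S := by
        by_contra h
        rw [hℓy, show ℓ y' = Sum.inr (κ' y') from if_neg h] at h1
        cases h1
      rw [hℓy, show ℓ y' = Sum.inl (st y', s y') from if_pos hy'S, Sum.inl.injEq,
        Prod.mk.injEq] at h1
      have h2 := hcs y' (hW₃W y' hy')
      rw [show c (β y') = c (β y) from congrArg Prod.fst h1.1, h1.2, hcs y (hW₃W y hyW)] at h2
      simp only [hQt, if_pos hyB, if_pos hy'B, Option.some_inj] at h2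
      exact h2.symm
    · obtain ⟨k, hk, hk'⟩ := hyL i
      have hfy : f i y = (T ^ k) y := hk'.self_of_nhds
      have hβ : β (f i y) = β y := by
        rw [hfy]
        refine blockBase_zpow_eq (hpast y (hW₃W y hyW)) (L := L) (fun j hj => ?_) hk
        have := hyD ⟨(j + L).toNat, by omega⟩
        simp only at this
        rwa [Int.toNat_of_nonneg (by omega), add_sub_cancel_right] at this
      have hst' : st (f i y) = st y := by simp only [hst, hβ]
      have hℓf : ℓ (f i y) = Sum.inl (st y, s (f i y)) := by
        simp only [hℓ, hst', if_pos hyS]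
      have hb1 : (T ^ (-ex (ℓ (f i y)))) (f i y) = β (f i y) := by rw [hℓf]; rfl
      have hb2 : (T ^ (-ex (ℓ y))) y = β y := by rw [hℓy]; rfl
      have hc1 : ch (ℓ (f i y)) = ch (ℓ y) := by rw [hℓf, hℓy]; rfl
      simp only [hb1, hb2, hc1, hβ]

end Refinement

/-! ### Measures of the pieces of an array -/

section ArrayMeasure

variable {X : Type u} [TopologicalSpace X] [MeasurableSpace X] [BorelSpace X] {T : X ≃ₜ X}
  {μ : Measure X} {ι : Type*}

theorem IsArray.measure_le {Z B : Set X} {I : Set ι} {ℓ : X → ι} {θ : ι → X → X}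
    (h : IsArray T Z B I ℓ θ) (hT : MeasurePreserving T μ μ) (hZ : IsCore T μ Z)
    (hB : ∀ x ∈ Z, LCAt (· ∈ B) x) {i j : ι} (hi : i ∈ I) (hj : j ∈ I) :
    μ (B ∩ {x | ℓ x = i}) ≤ μ (B ∩ {x | ℓ x = j}) := by
  refine measure_le_of_powAt hT (f := θ j) (fun x hx hxZ => h.powAt j hj x hxZ hx.1) hZ ?_
    (fun x hx hxZ => ⟨h.mem j hj x hxZ hx.1, h.label j hj x hxZ hx.1⟩) ?_
  · rintro x ⟨⟨hxB, hx⟩, hxZ⟩ y ⟨⟨hyB, hy⟩, hyZ⟩ hxy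
    rw [← h.self x hxZ hxB, ← h.self y hyZ hyB, show ℓ x = i from hx, show ℓ y = i from hy,
      ← h.trans j hj i hi x hxZ hxB, ← h.trans j hj i hi y hyZ hyB, hxy]
  · refine hZ.nullMeasurableSet fun x hx => ?_
    by_cases hxB : x ∈ B
    · exact (hB x hx).and ((h.lcAt_label x hx hxB).comp (fun a => a = i))
    · filter_upwards [hB x hx] with y hy
      simp only [mem_inter_iff, hy, hxB, false_and]

theorem IsArray.measure_eq {Z B : Set X} {I : Set ι} {ℓ : X → ι} {θ : ι → X → X}
    (h : IsArray T Z B I ℓ θ) (hT : MeasurePreserving T μ μ) (hZ : IsCore T μ Z)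
    (hB : ∀ x ∈ Z, LCAt (· ∈ B) x) {i j : ι} (hi : i ∈ I) (hj : j ∈ I) :
    μ (B ∩ {x | ℓ x = i}) = μ (B ∩ {x | ℓ x = j}) :=
  le_antisymm (h.measure_le hT hZ hB hi hj) (h.measure_le hT hZ hB hj hi)

theorem IsArray.measure_eq_div {Z B : Set X} {m : ℕ} {r : X → ℕ} {ρ : ℕ → X → X}
    (h : IsArray T Z B {v | v < m} r ρ) (hT : MeasurePreserving T μ μ) (hZ : IsCore T μ Z)
    (hB : ∀ x ∈ Z, LCAt (· ∈ B) x) (hm : m ≠ 0) :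
    μ (B ∩ {x | r x = 0}) = μ B / m := by
  have h1 : μ B = ∑ v ∈ Finset.range m, μ (B ∩ {x | r x = v}) := by
    rw [← measure_biUnion_finset₀]
    · apply measure_congr
      filter_upwards [hZ.ae_mem] with x hx
      refine propext ⟨fun hxB => mem_iUnion₂.2
        ⟨r x, Finset.mem_range.2 (h.label_mem x hx hxB), hxB, rfl⟩, fun hx => ?_⟩
      obtain ⟨v, -, hv⟩ := mem_iUnion₂.1 hx
      exact hv.1
    · intro v _ v' _ hvv'
      refine Disjoint.aedisjoint (Set.disjoint_left.2 fun x hx hx' => hvv' ?_)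
      exact (show _ = v from hx.2).symm.trans hx'.2
    · intro v _
      refine hZ.nullMeasurableSet fun x hx => ?_
      by_cases hxB : x ∈ B
      · exact (hB x hx).and ((h.lcAt_label x hx hxB).comp (fun a => a = v))
      · filter_upwards [hB x hx] with y hy
        simp only [mem_inter_iff, hy, hxB, false_and]
  have h2 : μ B = m * μ (B ∩ {x | r x = 0}) := by
    rw [h1, Finset.sum_congr rfl fun v hv => h.measure_eq hT hZ hB (Finset.mem_range.1 hv)
      (Nat.pos_of_ne_zero hm), Finset.sum_const, Finset.card_range, nsmul_eq_mul]
  rw [ENNReal.eq_div_iff (by exact_mod_cast hm) (by finiteness), h2]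

end ArrayMeasure

/-! ### Stages of the coding -/

section Stage

variable {X : Type u} [TopologicalSpace X]

/-- A stage of the construction: an array on all of `X` whose labels are sequences of digits. -/
structure Stage (X : Type u) where
  core : Set X
  labels : Set (ℕ → ℕ)
  label : X → ℕ → ℕ
  move : (ℕ → ℕ) → X → X

variable [MeasurableSpace X] [BorelSpace X]

/-- `s` is a stage with digits `0, …, n` (the remaining ones being `0`) and pieces of measure `c`.
Digit `0` runs over infinitely many values, since `X` has infinite measure. -/
structure IsStage (T : X ≃ₜ X) (μ : Measure X) (n : ℕ) (c : ℝ≥0∞) (s : Stage X) : Prop where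
  isCore : IsCore T μ s.core
  isArray : IsArray T s.core univ s.labels s.label s.move
  zero_mem : 0 ∈ s.labels
  eq_zero : ∀ w ∈ s.labels, ∀ i > n, w i = 0
  finite : ∀ j, {w ∈ s.labels | w 0 ≤ j}.Finite
  measure : μ {x | s.label x = 0} = c

/-- The stage `s'` refines the stage `s` with digits `0, …, n` by one more digit with `m` values.
The point `s.move 0 x` of the base `{s.label = 0}` determines the next digit and the next base
point; on a large open set the new pieces are compatible with `U 0, …, U n`, and `x`, `T x` have
the same new base point. -/
structure Refines (T : X ≃ₜ X) (μ : Measure X) (U : ℕ → Set X) (n m : ℕ) (s s' : Stage X) :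
    Prop where
  labels_eq : s'.labels = {w | Function.update w (n + 1) 0 ∈ s.labels ∧ w (n + 1) < m}
  digit : ∀ x ∈ s'.core, ∀ i ≠ n + 1, s'.label x i = s.label x i
  tail : ∀ x ∈ s'.core, ∀ y ∈ s'.core, s.move 0 x = s.move 0 y →
    s'.label x (n + 1) = s'.label y (n + 1) ∧ s'.move 0 x = s'.move 0 y
  good : ∃ O, IsOpen O ∧ μ {x | s.label x 0 ≤ n ∧ x ∉ O} ≤ (1 / 2) ^ n ∧
    ∀ x ∈ O, x ∈ s'.core → s.label x 0 ≤ n →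
      (∀ y ∈ s'.core, s'.label y = s'.label x → ∀ j ≤ n, (y ∈ U j ↔ x ∈ U j)) ∧
      s'.move 0 (T x) = s'.move 0 x

variable {T : X ≃ₜ X} {μ : Measure X} {g : X → ℝ}

/-- At the start `X` is divided into sets of measure `1`, delimited by thresholds of the coordinate
and identified with each other by Hopf equivalences. -/
theorem IsCoordinate.exists_isStage_zero (hg : IsCoordinate μ g) (hT : Ergodic T μ)
    (hμ : μ univ = ⊤) : ∃ s, IsStage T μ 0 1 s ∧ s.labels = {w | ∀ i > 0, w i = 0} := by
  have hmp := hT.toMeasurePreserving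
  have ht : ∀ i : ℕ, ∃ t, μ {x | g x < t} = i := fun i => by
    obtain ⟨t, ht⟩ := hg.exists_measure_inter_lt_eq (A := univ) nullMeasurableSet_univ
      (c := i) (by rw [hμ]; exact ENNReal.natCast_lt_top i)
    exact ⟨t, by rwa [univ_inter] at ht⟩
  choose t ht using ht
  have hmono : Monotone t := by
    intro i j hij
    by_contra hlt
    have h1 : μ {x | g x < t j} ≤ μ {x | g x < t i} :=
      measure_mono fun x (hx : g x < _) => hx.trans (not_le.1 hlt)
    rw [ht, ht, Nat.cast_le] at h1
    exact hlt (by rw [le_antisymm hij h1])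
  have hunb : ∀ x, ∃ i, g x < t (i + 1) := by
    intro x
    by_contra! hcon
    obtain ⟨n, hn⟩ := ENNReal.exists_nat_gt (hg.lt_ne_top (g x))
    have h1 : μ {y | g y < t (n + 1)} ≤ μ {y | g y < g x} :=
      measure_mono fun y (hy : g y < _) => hy.trans_le (hcon n)
    rw [ht] at h1
    have h2 := hn.trans_le ((Nat.cast_le.2 (Nat.le_succ n)).trans h1)
    exact lt_irrefl _ h2
  set idx : X → ℕ := fun x => sInf {i | g x < t (i + 1)} with hidx
  have hle : ∀ i, {x | idx x ≤ i} = {x | g x < t (i + 1)} := by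
    intro i
    ext x
    refine ⟨fun h => ?_, fun h => Nat.sInf_le h⟩
    have h1 : g x < t (idx x + 1) := Nat.sInf_mem (s := {i | g x < t (i + 1)}) (hunb x)
    exact h1.trans_le (hmono (Nat.succ_le_succ h))
  obtain ⟨Z, hZ, hlt⟩ := exists_isCore_lcAt_set hmp (fun i => {x | g x < t (i + 1)})
    fun i => hg.null_frontier_lt _
  have hlc : ∀ x ∈ Z, LCAt idx x := fun x hx =>
    LCAt.firstIndex (p := fun i x => g x < t (i + 1)) (hlt x hx) (hunb x)
  have hA1 : ∀ i, μ {x | idx x = i} = 1 := by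
    intro i
    cases i with
    | zero =>
      have := hle 0
      simp only [Nat.le_zero] at this
      rw [this, ht]; simp
    | succ i =>
      have h1 : {x | idx x ≤ i + 1} = {x | idx x ≤ i} ∪ {x | idx x = i + 1} := by
        ext x; simp only [mem_ofPred_eq, mem_union]; omega
      have h2 := measure_union₀ (μ := μ) (s := {x | idx x ≤ i}) (t := {x | idx x = i + 1})
        (hZ.nullMeasurableSet fun x hx => (hlc x hx).comp (fun a => a = i + 1))
        (Disjoint.aedisjoint (Set.disjoint_left.2 fun x (hx : idx x ≤ i) (hx' : idx x = i + 1) =>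
          by omega))
      rw [← h1, hle, hle, ht, ht] at h2
      push_cast at h2
      exact ((ENNReal.add_right_inj (by finiteness)).1 h2).symm
  have hAf : ∀ i, μ (frontier {x | idx x = i}) = 0 := fun i =>
    hZ.frontier_null fun x hx => (hlc x hx).comp (fun a => a = i)
  choose Y a b hY ha hb using fun i => exists_hopf_equivalence hT (hAf 0) (hAf i)
    ((hA1 0).trans (hA1 i).symm) (by rw [hA1]; exact ENNReal.one_ne_top)
  have hc : IsCore T μ (Z ∩ ⋂ i, Y i) := hZ.inter (IsCore.iInter hY)
  have harr := IsArray.of_chunks (B := univ) (E := {x | idx x = 0}) hc (J := univ) (ℓ := idx)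
    (ch := fun i => i) (ex := fun _ => 0) (C := fun i => {x | idx x = i}) (a := a) (b := b)
    (fun x hx _ => hlc x hx.1) (fun x _ _ => ⟨mem_univ _, rfl⟩)
    (fun p _ z _ hz => ⟨mem_univ _, hz⟩) (fun p _ x hx => ha p x (mem_iInter.1 hx.2 p))
    (fun p _ x hx => hb p x (mem_iInter.1 hx.2 p))
  have harr' := harr.relabel (J := {w : ℕ → ℕ | ∀ i > 0, w i = 0}) (f := fun i => Pi.single 0 i)
    (g := fun w => w 0)
    (fun i _ => ⟨fun j hj => by simp [hj.ne'], by simp⟩)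
    (fun w hw => ⟨mem_univ _, by
      funext j
      rcases Nat.eq_zero_or_pos j with rfl | hj
      · exact Pi.single_eq_same _ _
      · rw [Pi.single_eq_of_ne hj.ne', hw j hj]⟩)
  refine ⟨⟨_, {w | ∀ i > 0, w i = 0}, fun x => Pi.single 0 (idx x), _⟩,
    ⟨hc, harr', fun i _ => rfl, fun w hw => hw, fun j => ?_, ?_⟩, rfl⟩
  · refine ((finite_le_nat j).image fun v => (Pi.single 0 v : ℕ → ℕ)).subset ?_
    rintro w ⟨hw, hwj⟩
    refine ⟨w 0, hwj, ?_⟩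
    funext i
    rcases Nat.eq_zero_or_pos i with rfl | hi
    · exact Pi.single_eq_same _ _
    · exact (Pi.single_eq_of_ne hi.ne' _).trans (hw i hi).symm
  · rw [← hA1 0]
    congr 1
    ext x
    simp only [mem_ofPred_eq, Pi.single_eq_zero_iff]

/-- The refinement step is applied to the base of the stage. The labelling `Q` of the base records
the position of the points `s.move w y` relative to `U 0, …, U n`, and the connections `f w` lead
from `y` to the base point of `T (s.move w y)`. Only the finitely many labels `w` with `w 0 ≤ n` are
considered; eventually every label is. -/
theorem IsStage.exists_refines {n : ℕ} {c : ℝ≥0∞} {s : Stage X} (hs : IsStage T μ n c s)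
    (hg : IsCoordinate μ g) (hT : Ergodic T μ) (hc0 : c ≠ 0) (hct : c ≠ ⊤) {U : ℕ → Set X}
    (hU : ∀ j, μ (frontier (U j)) = 0) :
    ∃ k₀ : ℕ, k₀ ≠ 0 ∧ ∀ m ≥ k₀, ∃ s', IsStage T μ (n + 1) (c / m) s' ∧ Refines T μ U n m s s' := by
  have hmp := hT.toMeasurePreserving
  obtain ⟨ZU, hZU, hUlc⟩ := exists_isCore_lcAt_set hmp U hU
  have hs0 := hs.zero_mem
  have harr := hs.isArray
  set Z := s.core ∩ ZU with hZdef
  have hZ : IsCore T μ Z := hs.isCore.inter hZU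
  set B : Set X := {x | s.label x = 0} with hBdef
  have hBlc : ∀ x ∈ Z, LCAt (· ∈ B) x := fun x hx =>
    (harr.lcAt_label x hx.1 (mem_univ x)).comp (fun w => w = 0)
  have hmv : ∀ w ∈ s.labels, ∀ x ∈ Z, PowAt T (s.move w) x ∧ s.move w x ∈ Z := fun w hw x hx =>
    ⟨harr.powAt w hw x hx.1 (mem_univ x), hZ.powAt_mem (harr.powAt w hw x hx.1 (mem_univ x)) hx⟩
  have hTZ : ∀ x ∈ Z, T x ∈ Z := fun x hx => hZ.zpow_mem 1 hx
  have hbase : ∀ x ∈ Z, s.move 0 x ∈ B := fun x hx => harr.label 0 hs0 x hx.1 (mem_univ x)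
  let Fw := {w // w ∈ s.labels ∧ w 0 ≤ n}
  have hFw : Finite Fw := hs.finite n
  cases nonempty_fintype Fw
  obtain ⟨k₀, hk₀, hk⟩ := hg.exists_isArray hT hZ hBlc (by rw [hs.measure]; exact hc0)
    (by rw [hs.measure]; exact hct) (F := Fw)
    (Q := fun y (p : Fw × Fin (n + 1)) => s.move p.1 y ∈ U p.2)
    (f := fun w y => s.move 0 (T (s.move w y)))
    (fun x hx _ => LCAt.pi fun p => LCAt.comp_powAt (l := (· ∈ U p.2))
      (hUlc _ (hmv p.1 p.1.2.1 x hx).2.2 _) (hmv p.1 p.1.2.1 x hx).1)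
    (fun w x hx _ => by
      have h1 := hmv w w.2.1 x hx
      refine ⟨?_, hbase _ (hTZ _ h1.2)⟩
      exact PowAt.comp (g := s.move 0) (hmv 0 hs0 _ (hTZ _ h1.2)).1
        (PowAt.comp (g := fun y => T y) (PowAt.zpow T 1 _) h1.1))
    (ε := (1 / 2) ^ n / (Fintype.card Fw + 1)) (ENNReal.div_ne_zero.2 ⟨by simp, by finiteness⟩)
  refine ⟨k₀, hk₀, fun m hm => ?_⟩
  obtain ⟨W, r, ρ, O, hWZ, hW, hr, hO, hOm, hgood⟩ := hk m hm
  have hm0 : 0 < m := by omega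
  have hBW : ∀ x ∈ W, LCAt (· ∈ B) x := fun x hx => hBlc x (hWZ hx)
  have hmvW : ∀ w ∈ s.labels, ∀ x ∈ W, s.move w x ∈ W := fun w hw x hx =>
    hW.powAt_mem (hmv w hw x (hWZ hx)).1 hx
  have hbW : ∀ x ∈ W, s.move 0 x ∈ W ∧ s.move 0 x ∈ B := fun x hx =>
    ⟨hmvW 0 hs0 x hx, hbase x (hWZ hx)⟩
  have hself : ∀ y ∈ W, y ∈ B → s.move 0 y = y := fun y hy hyB => by
    have := harr.self y (hWZ hy).1 (mem_univ y)
    rwa [show s.label y = 0 from hyB] at this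
  have hlab0 : ∀ x ∈ W, s.label x (n + 1) = 0 := fun x hx =>
    hs.eq_zero _ (harr.label_mem x (hWZ hx).1 (mem_univ x)) _ (Nat.lt_succ_self n)
  have hrec : ∀ x ∈ W, s.move (s.label x) (s.move 0 x) = x := fun x hx => by
    have h1 := harr.label_mem x (hWZ hx).1 (mem_univ x)
    rw [harr.trans 0 hs0 _ h1 x (hWZ hx).1 (mem_univ x), harr.self x (hWZ hx).1 (mem_univ x)]
  set lab : X → ℕ → ℕ := fun x => Function.update (s.label x) (n + 1) (r (s.move 0 x)) with hlab
  set mv : (ℕ → ℕ) → X → X := fun w x =>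
    s.move (Function.update w (n + 1) 0) (ρ (w (n + 1)) (s.move 0 x)) with hmvdef
  set I : Set (ℕ → ℕ) := {w | Function.update w (n + 1) 0 ∈ s.labels ∧ w (n + 1) < m} with hI
  -- the point `ρ v (s.move 0 x)` of the base and its image under `s.move w`
  have hpt : ∀ v < m, ∀ w ∈ s.labels, ∀ x ∈ W, ∀ y, y = s.move 0 x →
      ρ v y ∈ W ∧ ρ v y ∈ B ∧ s.move 0 (s.move w (ρ v y)) = ρ v y ∧ s.label (s.move w (ρ v y)) = w
        ∧ PowAt T (ρ v) y := by
    rintro v hv w hw x hx y rfl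
    obtain ⟨h1, h2⟩ := hbW x hx
    have h3 := hr.powAt v hv _ h1 h2
    have h4 : ρ v (s.move 0 x) ∈ W := hW.powAt_mem h3 h1
    have h5 := hr.mem v hv _ h1 h2
    refine ⟨h4, h5, ?_, harr.label w hw _ (hWZ h4).1 (mem_univ _), h3⟩
    rw [harr.trans w hw 0 hs0 _ (hWZ h4).1 (mem_univ _), hself _ h4 h5]
  have hlabr : ∀ x ∈ W, Function.update (lab x) (n + 1) 0 = s.label x := fun x hx => by
    simp only [hlab, Function.update_idem]
    rw [← hlab0 x hx, Function.update_eq_self]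
  have harr' : IsArray T W univ I lab mv := by
    refine ⟨?_, ?_, ?_, fun _ _ _ _ _ => mem_univ _, ?_, ?_, ?_⟩
    · intro x hx _
      refine ⟨?_, ?_⟩
      · rw [hlabr x hx]; exact harr.label_mem x (hWZ hx).1 (mem_univ x)
      · simp only [hlab, Function.update_self]
        exact hr.label_mem _ (hbW x hx).1 (hbW x hx).2
    · intro x hx _
      exact ((harr.lcAt_label x (hWZ hx).1 (mem_univ x)).prodMk
        (LCAt.comp_powAt (hr.lcAt_label _ (hbW x hx).1 (hbW x hx).2) (hmv 0 hs0 x (hWZ hx)).1)).comp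
        (fun p : (ℕ → ℕ) × ℕ => Function.update p.1 (n + 1) p.2)
    · intro w hw x hx _
      obtain ⟨h1, -, -, -, h2⟩ := hpt _ hw.2 _ hw.1 x hx _ rfl
      exact PowAt.comp (g := s.move (Function.update w (n + 1) 0)) (hmv _ hw.1 _ (hWZ h1)).1
        (PowAt.comp (g := ρ (w (n + 1))) h2 (hmv 0 hs0 x (hWZ hx)).1)
    · intro w hw x hx _
      obtain ⟨-, -, h1, h2, -⟩ := hpt _ hw.2 _ hw.1 x hx _ rfl
      simp only [hlab, hmvdef, h1, h2, hr.label _ hw.2 _ (hbW x hx).1 (hbW x hx).2,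
        Function.update_idem, Function.update_eq_self]
    · intro w hw w' hw' x hx _
      obtain ⟨-, -, h1, -, -⟩ := hpt _ hw.2 _ hw.1 x hx _ rfl
      simp only [hmvdef, h1, hr.trans _ hw.2 _ hw'.2 _ (hbW x hx).1 (hbW x hx).2]
    · intro x hx _
      change s.move (Function.update (lab x) (n + 1) 0) (ρ (lab x (n + 1)) (s.move 0 x)) = x
      rw [hlabr x hx, show lab x (n + 1) = r (s.move 0 x) from Function.update_self ..,
        hr.self _ (hbW x hx).1 (hbW x hx).2, hrec x hx]
  refine ⟨⟨W, I, lab, mv⟩, ⟨hW, harr', ?_, ?_, ?_, ?_⟩, ⟨rfl, ?_, ?_, ?_⟩⟩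
  · refine ⟨?_, hm0⟩
    have : Function.update (0 : ℕ → ℕ) (n + 1) 0 = 0 := Function.update_eq_self _ _
    rw [this]; exact hs0
  · intro w hw i hi
    have := hs.eq_zero _ hw.1 i (by omega)
    rwa [Function.update_of_ne (by omega)] at this
  · intro j
    refine (((hs.finite j).prod (finite_lt_nat m)).image
      fun p : (ℕ → ℕ) × ℕ => Function.update p.1 (n + 1) p.2).subset ?_
    rintro w ⟨hw, hwj⟩
    refine ⟨(Function.update w (n + 1) 0, w (n + 1)), ⟨⟨hw.1, ?_⟩, hw.2⟩, by simp⟩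
    change Function.update w (n + 1) 0 0 ≤ j
    rwa [Function.update_of_ne (by omega)]
  · rw [← hs.measure, ← hr.measure_eq_div hmp hW hBW hm0.ne']
    apply measure_congr
    filter_upwards [hW.ae_mem] with x hx
    refine propext ⟨fun (h : lab x = 0) => ?_, fun h => ?_⟩
    · have h1 : s.label x = 0 := by
        rw [← hlabr x hx, h]; exact Function.update_eq_self _ _
      refine ⟨h1, ?_⟩
      have h2 := congrFun h (n + 1)
      simp only [hlab, Function.update_self, hself x hx h1] at h2
      exact h2
    · have h1 : s.label x = 0 := h.1
      change lab x = 0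
      simp only [hlab, hself x hx h.1, h1, show r x = 0 from h.2]
      exact Function.update_eq_self _ _
  · intro x hx i hi
    exact Function.update_of_ne hi _ _
  · intro x hx y hy hxy
    simp only [hlab, hmvdef, Function.update_self, hxy, and_self]
  · set O' : Set X := interior {x | s.move 0 x ∈ O} with hO'
    have hWO : ∀ x ∈ W, s.move 0 x ∈ O → x ∈ O' := fun x hx hxO =>
      mem_interior_iff_mem_nhds.2
        ((hmv 0 hs0 x (hWZ hx)).1.continuousAt.preimage_mem_nhds (hO.mem_nhds hxO))
    refine ⟨O', isOpen_interior, ?_, ?_⟩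
    · have hpc : ∀ w : Fw, μ ({x | s.label x = w} \ O') ≤ μ (B \ O) := by
        intro w
        refine measure_le_of_powAt hmp (f := s.move 0)
          (fun x _ hxW => (hmv 0 hs0 x (hWZ hxW)).1) hW ?_ ?_ ?_
        · rintro x ⟨⟨hx, -⟩, hxW⟩ y ⟨⟨hy, -⟩, hyW⟩ hxy
          rw [← hrec x hxW, ← hrec y hyW, show s.label x = w from hx, show s.label y = w from hy, hxy]
        · intro x hx hxW
          exact ⟨(hbW x hxW).2, fun h => hx.2 (hWO x hxW h)⟩
        · exact (hW.nullMeasurableSet fun x hx =>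
            (harr.lcAt_label x (hWZ hx).1 (mem_univ x)).comp (fun a => a = (w : ℕ → ℕ))).diff
            isOpen_interior.measurableSet.nullMeasurableSet
      calc μ {x | s.label x 0 ≤ n ∧ x ∉ O'} ≤ μ (Wᶜ ∪ ⋃ w : Fw, {x | s.label x = w} \ O') := by
            refine measure_mono fun x hx => ?_
            by_cases hxW : x ∈ W
            · exact Or.inr (mem_iUnion.2 ⟨⟨s.label x,
                harr.label_mem x (hWZ hxW).1 (mem_univ x), hx.1⟩, rfl, hx.2⟩)
            · exact Or.inl hxW
        _ ≤ μ Wᶜ + ∑ w : Fw, μ ({x | s.label x = w} \ O') :=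
            (measure_union_le _ _).trans (add_le_add_right (measure_iUnion_fintype_le _ _) _)
        _ ≤ 0 + ∑ _w : Fw, (1 / 2 : ℝ≥0∞) ^ n / (Fintype.card Fw + 1) :=
            add_le_add hW.null.le (Finset.sum_le_sum fun w _ => (hpc w).trans hOm)
        _ = (Fintype.card Fw : ℝ≥0∞) * ((1 / 2) ^ n / (Fintype.card Fw + 1)) := by
            rw [zero_add, Finset.sum_const, Finset.card_univ, nsmul_eq_mul]
        _ ≤ (Fintype.card Fw + 1 : ℝ≥0∞) * ((1 / 2) ^ n / (Fintype.card Fw + 1)) := by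
            gcongr
            exact le_self_add
        _ ≤ (1 / 2) ^ n := ENNReal.mul_div_le
    · intro x hxO hx hxn
      have hx1 : s.move 0 x ∈ O := (interior_subset hxO : x ∈ {x | s.move 0 x ∈ O})
      obtain ⟨h1, h2⟩ := hgood _ hx1 (hbW x hx).1 (hbW x hx).2
      let w : Fw := ⟨s.label x, harr.label_mem x (hWZ hx).1 (mem_univ x), hxn⟩
      refine ⟨fun y hy hyx j hj => ?_, ?_⟩
      · have h3 : s.label y = s.label x := by
          rw [← hlabr x hx, ← hlabr y hy, show lab y = lab x from hyx]
        have h4 : r (s.move 0 y) = r (s.move 0 x) := by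
          have := congrFun hyx (n + 1)
          simpa only [hlab, Function.update_self] using this
        have h5 := congrFun (h1 _ (hbW y hy).1 (hbW y hy).2 h4) (w, ⟨j, by omega⟩)
        simp only [w, eq_iff_iff] at h5
        rw [hrec x hx] at h5
        rw [← h3, hrec y hy] at h5
        exact h5
      · have h3 := h2 w
        simp only [w, hrec x hx] at h3
        simp only [hmvdef, Pi.zero_apply, h3]

end Stage

/-! ### The coding by sequences of digits -/

section Coding

/-- The sequence of digits `s` with all digits beyond the `n`-th replaced by `0`. -/
def truncate (n : ℕ) (s : ℕ → ℕ) : ℕ → ℕ := fun i => if i ≤ n then s i else 0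

theorem truncate_eq_truncate_iff {n : ℕ} {s t : ℕ → ℕ} :
    truncate n s = truncate n t ↔ ∀ i ≤ n, s i = t i := by
  constructor
  · intro h i hi
    have := congrFun h i
    simpa only [truncate, if_pos hi] using this
  · intro h
    funext i
    by_cases hi : i ≤ n
    · simp only [truncate, if_pos hi, h i hi]
    · simp only [truncate, if_neg hi]

variable {X : Type u} [TopologicalSpace X] [MeasurableSpace X] [BorelSpace X]

/-- `Φ` codes the points of a core `C` by sequences of digits, in such a way that the `T`-orbits
correspond to the classes of the tail equivalence relation on the sequences all of whose initial
segments belong to `I`, and that the cylinder of an initial segment in `I n` has measure `c n`. -/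
structure IsCoding (T : X ≃ₜ X) (μ : Measure X) (I : ℕ → Set (ℕ → ℕ)) (c : ℕ → ℝ≥0∞) (C : Set X)
    (Φ : X → ℕ → ℕ) : Prop where
  isCore : IsCore T μ C
  isEmbedding : IsEmbedding fun x : C => Φ x
  image_zorbit : ∀ x ∈ C, Φ '' zorbit T x =
    {t | (∀ n, truncate n t ∈ I n) ∧ ∃ n, ∀ i > n, t i = Φ x i}
  measure_mem : ∀ n, ∀ w ∈ I n, μ (C ∩ {x | truncate n (Φ x) = w}) = c n
  measure_notMem : ∀ n, ∀ w ∉ I n, μ (C ∩ {x | truncate n (Φ x) = w}) = 0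

variable {T : X ≃ₜ X} {μ : Measure X} {U : ℕ → Set X} {S : ℕ → Stage X} {c : ℕ → ℝ≥0∞} {m : ℕ → ℕ}

/-- The sequence of digits assigned to `x` by an infinite sequence of stages. -/
def digits (S : ℕ → Stage X) (x : X) (n : ℕ) : ℕ := (S n).label x n

theorem label_eq_truncate_digits (hS : ∀ n, IsStage T μ n (c n) (S n))
    (hR : ∀ n, Refines T μ U n (m n) (S n) (S (n + 1))) {x : X} (hx : ∀ n, x ∈ (S n).core) (n : ℕ) :
    (S n).label x = truncate n (digits S x) := by
  have h : ∀ n i, i ≤ n → (S n).label x i = digits S x i := by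
    intro n i hi
    induction n, hi using Nat.le_induction with
    | base => rfl
    | succ n hn ih => rw [(hR n).digit x (hx _) i (by omega), ih]
  funext i
  by_cases hi : i ≤ n
  · simp only [truncate, if_pos hi, h n i hi]
  · simp only [truncate, if_neg hi]
    exact (hS n).eq_zero _ ((hS n).isArray.label_mem x (hx n) (mem_univ x)) i (by omega)

theorem digits_eq_of_move_eq (hR : ∀ n, Refines T μ U n (m n) (S n) (S (n + 1))) {x y : X}
    (hx : ∀ n, x ∈ (S n).core) (hy : ∀ n, y ∈ (S n).core) {n : ℕ}
    (hxy : (S n).move 0 x = (S n).move 0 y) : ∀ i > n, digits S x i = digits S y i := by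
  have h : ∀ N ≥ n, (S N).move 0 x = (S N).move 0 y := by
    intro N hN
    induction N, hN using Nat.le_induction with
    | base => exact hxy
    | succ N _ ih => exact ((hR N).tail x (hx _) y (hy _) ih).2
  intro i hi
  obtain ⟨i, rfl⟩ : ∃ j, i = j + 1 := ⟨i - 1, by omega⟩
  exact ((hR i).tail x (hx _) y (hy _) (h i (by omega))).1

theorem measure_zero_of_le_half_pow {A : Set X} {K : ℕ} (h : ∀ n ≥ K, μ A ≤ (1 / 2) ^ n) :
    μ A = 0 := by
  refine le_antisymm (ge_of_tendsto (ENNReal.tendsto_pow_atTop_nhds_zero_of_lt_one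
    (r := 1 / 2) ?_) ?_) zero_le
  · simp
  · exact (eventually_ge_atTop K).mono h

/-- The points which lie infinitely often in the good set of a stage form a `G_δ` of full measure.
This is why the coding can be inverted continuously on a `G_δ` set: "eventually good" would only
define an `F_σ`. -/
theorem exists_isCore_frequently_good (hT : MeasurePreserving T μ μ)
    (hS : ∀ n, IsStage T μ n (c n) (S n)) (hR : ∀ n, Refines T μ U n (m n) (S n) (S (n + 1))) :
    ∃ C, IsCore T μ C ∧ (∀ x ∈ C, ∀ n, x ∈ (S n).core) ∧ ∀ x ∈ C, ∀ N, ∃ n ≥ N,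
      (∀ y ∈ C, truncate (n + 1) (digits S y) = truncate (n + 1) (digits S x) →
        ∀ j ≤ n, (y ∈ U j ↔ x ∈ U j)) ∧ (S (n + 1)).move 0 (T x) = (S (n + 1)).move 0 x := by
  choose O hO hOm hOg using fun n => (hR n).good
  have hC₀ : IsCore T μ (⋂ n, (S n).core) := IsCore.iInter fun n => (hS n).isCore
  set G : ℕ → Set X := fun N => ⋃ n ≥ N, interior {x | (S n).label x 0 ≤ n} ∩ O n with hG
  have hGo : ∀ N, IsOpen (G N) := fun N =>
    isOpen_biUnion fun n _ => isOpen_interior.inter (hO n)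
  have hGm : ∀ N, μ (G N)ᶜ = 0 := by
    intro N
    have hsub : (G N)ᶜ ⊆ (⋂ n, (S n).core)ᶜ ∪
        ⋃ k, {x | x ∈ (⋂ n, (S n).core) ∧ digits S x 0 = k ∧ x ∉ G N} := by
      intro x hx
      by_cases hxC : x ∈ ⋂ n, (S n).core
      · exact Or.inr (mem_iUnion.2 ⟨_, hxC, rfl, hx⟩)
      · exact Or.inl hxC
    refine measure_mono_null hsub (measure_union_null hC₀.null (measure_iUnion_null fun k => ?_))
    refine measure_zero_of_le_half_pow (K := max N k) fun n hn => ?_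
    refine (measure_mono ?_).trans (hOm n)
    rintro x ⟨hxC, hxk, hxG⟩
    have hxC' := mem_iInter.1 hxC
    have h0 : (S n).label x 0 ≤ n := by
      rw [label_eq_truncate_digits hS hR hxC' n]
      simp only [truncate, Nat.zero_le, if_true, hxk]
      exact (le_max_right _ _).trans hn
    refine ⟨h0, fun hxO => hxG (mem_iUnion₂.2 ⟨n, (le_max_left _ _).trans hn, ?_, hxO⟩)⟩
    exact (((hS n).isArray.lcAt_label x (hxC' n) (mem_univ x)).comp
      (fun w : ℕ → ℕ => w 0 ≤ n)).mem_interior h0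
  obtain ⟨C, hCG, hC⟩ := exists_isCore_subset hT (IsGδ.iInter_of_isOpen hGo) (by
    rw [compl_iInter, measure_iUnion_null_iff]; exact hGm)
  refine ⟨(⋂ n, (S n).core) ∩ C, hC₀.inter hC, fun x hx => mem_iInter.1 hx.1, fun x hx N => ?_⟩
  obtain ⟨n, hn, hxn, hxO⟩ := mem_iUnion₂.1 (mem_iInter.1 (hCG hx.2) N)
  obtain ⟨h1, h2⟩ := hOg n x hxO (mem_iInter.1 hx.1 _)
    (interior_subset hxn : x ∈ {x | (S n).label x 0 ≤ n})
  refine ⟨n, hn, fun y hy hyx => h1 y (mem_iInter.1 hy.1 _) ?_, h2⟩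
  rw [label_eq_truncate_digits hS hR (mem_iInter.1 hy.1),
    label_eq_truncate_digits hS hR (mem_iInter.1 hx.1), hyx]

/-- The digits of an infinite sequence of refining stages form a coding. A point that is good at the
stage `n + 1` has a cylinder contained in each `U j` with `j ≤ n` that contains it, which makes the
coding an embedding, and its digits agree with those of its image under `T` from that stage on. -/
theorem exists_isCoding [T2Space X] (hT : MeasurePreserving T μ μ)
    (hU : ∀ x, ∀ V ∈ 𝓝 x, ∃ j, x ∈ U j ∧ U j ⊆ V)
    (hS : ∀ n, IsStage T μ n (c n) (S n)) (hR : ∀ n, Refines T μ U n (m n) (S n) (S (n + 1))) :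
    ∃ C, IsCoding T μ (fun n => (S n).labels) c C (digits S) := by
  obtain ⟨C, hC, hCS, hgood⟩ := exists_isCore_frequently_good hT hS hR
  have hlab : ∀ x ∈ C, ∀ n, (S n).label x = truncate n (digits S x) := fun x hx =>
    label_eq_truncate_digits hS hR (hCS x hx)
  have hlabI : ∀ x ∈ C, ∀ n, truncate n (digits S x) ∈ (S n).labels := fun x hx n => by
    rw [← hlab x hx n]; exact (hS n).isArray.label_mem x (hCS x hx n) (mem_univ x)
  have hcyl : ∀ n w, ∀ x ∈ C, (truncate n (digits S x) = w ↔ (S n).label x = w) := fun n w x hx => by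
    rw [hlab x hx n]
  refine ⟨C, hC, ⟨?_, ?_⟩, fun x hx => ?_, fun n w hw => ?_, fun n w hw => ?_⟩
  · rw [isInducing_iff_nhds]
    intro x
    refine le_antisymm ?_ ?_
    · refine Tendsto.le_comap ?_
      rw [tendsto_pi_nhds]
      intro n
      have h1 : LCAt (fun y => digits S y n) (x : X) :=
        ((hS n).isArray.lcAt_label x (hCS x x.2 n) (mem_univ _)).comp (fun w : ℕ → ℕ => w n)
      exact tendsto_const_nhds.congr' ((continuous_subtype_val.continuousAt.eventually h1).mono
        fun y hy => hy.symm)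
    · intro V hV
      obtain ⟨V', hV', hVV'⟩ := mem_nhds_subtype _ _ _ |>.1 hV
      obtain ⟨j, hxj, hj⟩ := hU x V' hV'
      obtain ⟨n, hn, h1, -⟩ := hgood x x.2 j
      refine mem_comap.2 ⟨{t | ∀ i : Fin (n + 2), t i = digits S x i}, ?_, ?_⟩
      · refine eventually_all.2 fun i => ?_
        exact (continuous_apply (i : ℕ)).continuousAt.eventually
          (show ∀ᶠ k in 𝓝 (digits S x i), k = digits S x i by simp)
      · intro y hy
        refine hVV' (hj ((h1 y y.2 (truncate_eq_truncate_iff.2 fun i hi => ?_) j hn).2 hxj))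
        exact hy ⟨i, by omega⟩
  · intro x y hxy
    by_contra hne
    obtain ⟨j, hxj, hj⟩ := hU x {(y : X)}ᶜ
      (isOpen_compl_singleton.mem_nhds fun h => hne (Subtype.ext h))
    obtain ⟨n, hn, h1, -⟩ := hgood x x.2 j
    have hxy' : digits S x = digits S y := hxy
    exact hj ((h1 y y.2 (by rw [hxy']) j hn).2 hxj) rfl
  · refine Subset.antisymm ?_ ?_
    · rintro _ ⟨_, ⟨k, rfl⟩, rfl⟩
      refine ⟨fun n => hlabI _ (hC.zpow_mem k hx) n, ?_⟩
      have hstep : ∀ z ∈ C, ∃ n, ∀ i > n, digits S (T z) i = digits S z i := by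
        intro z hz
        obtain ⟨n, -, -, h2⟩ := hgood z hz 0
        exact ⟨n + 1, digits_eq_of_move_eq hR (hCS _ (hC.zpow_mem 1 hz)) (hCS z hz) h2⟩
      change ∃ n, ∀ i > n, digits S ((T ^ k) x) i = digits S x i
      induction k with
      | zero => exact ⟨0, fun _ _ => rfl⟩
      | succ k ih =>
        obtain ⟨n, hn⟩ := ih
        obtain ⟨n', hn'⟩ := hstep _ (hC.zpow_mem k hx)
        refine ⟨max n n', fun i hi => ?_⟩
        rw [add_comm, zpow_add_apply]
        exact (hn' i (lt_of_le_of_lt (le_max_right _ _) hi)).trans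
          (hn i (lt_of_le_of_lt (le_max_left _ _) hi))
      | pred k ih =>
        obtain ⟨n, hn⟩ := ih
        obtain ⟨n', hn'⟩ := hstep _ (hC.zpow_mem (-(k : ℤ) - 1) hx)
        refine ⟨max n n', fun i hi => ?_⟩
        rw [← hn' i (lt_of_le_of_lt (le_max_right _ _) hi),
          ← hn i (lt_of_le_of_lt (le_max_left _ _) hi), show T = T ^ (1 : ℤ) from rfl,
          ← zpow_mul, one_mul, ← zpow_add_apply]
        congr 3
        ring
    · rintro t ⟨ht, n, htn⟩
      have harr := (hS n).isArray
      have hxn := hCS x hx n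
      have hp := harr.powAt _ (ht n) x hxn (mem_univ x)
      have hyC := hC.powAt_mem hp hx
      obtain ⟨k, hk⟩ := hp.exists_eq
      refine ⟨(S n).move (truncate n t) x, ⟨k, hk.symm⟩, ?_⟩
      funext i
      by_cases hi : i ≤ n
      · have h1 := harr.label _ (ht n) x hxn (mem_univ x)
        rw [hlab _ hyC n] at h1
        exact truncate_eq_truncate_iff.1 h1 i hi
      · rw [htn i (by omega)]
        exact digits_eq_of_move_eq hR (hCS _ hyC) (hCS x hx)
          (harr.trans _ (ht n) 0 (hS n).zero_mem x hxn (mem_univ x)) i (by omega)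
  · have h1 := (hS n).isArray.measure_eq hT (hS n).isCore
      (fun x _ => LCAt.comp (f := fun _ => True) (LCAt.const True x) (fun _ => x ∈ (univ : Set X)))
      hw (hS n).zero_mem
    rw [univ_inter, univ_inter, (hS n).measure] at h1
    rw [← h1]
    apply measure_congr
    filter_upwards [hC.ae_mem] with x hx
    exact propext ⟨fun h => (hcyl n w x hx).1 h.2, fun h => ⟨hx, (hcyl n w x hx).2 h⟩⟩
  · convert measure_empty (μ := μ)
    ext x
    simp only [mem_inter_iff, mem_ofPred_eq, mem_empty_iff_false, iff_false, not_and]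
    rintro hx rfl
    exact hw (hlabI x hx n)

theorem IsCoding.mono {I : ℕ → Set (ℕ → ℕ)} {C C' : Set X} {Φ : X → ℕ → ℕ}
    (h : IsCoding T μ I c C Φ) (hC' : IsCore T μ C') (hsub : C' ⊆ C) : IsCoding T μ I c C' Φ where
  isCore := hC'
  isEmbedding := h.isEmbedding.comp (IsEmbedding.inclusion hsub)
  image_zorbit x hx := h.image_zorbit x (hsub hx)
  measure_mem n w hw := by
    rw [← h.measure_mem n w hw]
    apply measure_congr
    filter_upwards [hC'.ae_mem] with x hx
    exact propext ⟨fun h => ⟨hsub hx, h.2⟩, fun h => ⟨hx, h.2⟩⟩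
  measure_notMem n w hw := measure_mono_null (inter_subset_inter_left _ hsub)
    (h.measure_notMem n w hw)

end Coding

/-! ### Embeddings of `G_δ` sets -/

section Range

/-- The range of an embedding of a `G_δ` subset of a Polish space is a `G_δ`: a point `s` of its
closure belongs to it exactly when the preimages of the neighbourhoods of `s` have arbitrarily small
diameter, and shrink into each of the open sets which define the domain. -/
theorem Topology.IsEmbedding.isGδ_range {X : Type*} [TopologicalSpace X] [PolishSpace X]
    {M : Type*} [TopologicalSpace M] [TopologicalSpace.MetrizableSpace M] {C : Set X} (hC : IsGδ C)
    {f : C → M} (hf : IsEmbedding f) : IsGδ (range f) := by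
  let _ := TopologicalSpace.upgradeIsCompletelyMetrizable X
  let _ := TopologicalSpace.metrizableSpaceMetric M
  obtain ⟨V, hVo, hCV⟩ := isGδ_iff_eq_iInter_nat.1 hC
  set P : ℕ → Set M := fun n => {s | ∃ W, IsOpen W ∧ s ∈ W ∧
    ∀ y y' : C, f y ∈ W → f y' ∈ W → dist (y : X) y' < 1 / (n + 1)} with hP
  set R : ℕ → Set M := fun n => {s | ∃ W, IsOpen W ∧ s ∈ W ∧
    closure ((↑) '' (f ⁻¹' W) : Set X) ⊆ V n} with hR
  have hPo : ∀ n, IsOpen (P n) := fun n => isOpen_iff_forall_mem_open.2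
    fun s ⟨W, hW, hs, h⟩ => ⟨W, fun t ht => ⟨W, hW, ht, h⟩, hW, hs⟩
  have hRo : ∀ n, IsOpen (R n) := fun n => isOpen_iff_forall_mem_open.2
    fun s ⟨W, hW, hs, h⟩ => ⟨W, fun t ht => ⟨W, hW, ht, h⟩, hW, hs⟩
  have hpull : ∀ (x : C) (A : Set X), A ∈ 𝓝 (x : X) →
      ∃ W, IsOpen W ∧ f x ∈ W ∧ ∀ y : C, f y ∈ W → (y : X) ∈ A := by
    intro x A hA
    have h1 : ((↑) : C → X) ⁻¹' A ∈ 𝓝 x := continuous_subtype_val.continuousAt hA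
    rw [hf.isInducing.nhds_eq_comap] at h1
    obtain ⟨W', hW', hWA⟩ := h1
    obtain ⟨W, hWW', hWo, hxW⟩ := mem_nhds_iff.1 hW'
    exact ⟨W, hWo, hxW, fun y hy => hWA (hWW' hy)⟩
  suffices h : range f = closure (range f) ∩ ((⋂ n, P n) ∩ ⋂ n, R n) by
    rw [h]
    exact isClosed_closure.isGδ.inter ((IsGδ.iInter_of_isOpen hPo).inter (IsGδ.iInter_of_isOpen hRo))
  refine Subset.antisymm ?_ ?_
  · rintro _ ⟨x, rfl⟩
    refine ⟨subset_closure ⟨x, rfl⟩, mem_iInter.2 fun n => ?_, mem_iInter.2 fun n => ?_⟩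
    · have hpos : (0 : ℝ) < 1 / (n + 1) / 2 := by positivity
      obtain ⟨W, hWo, hxW, hW⟩ := hpull x _ (Metric.ball_mem_nhds (x : X) hpos)
      refine ⟨W, hWo, hxW, fun y y' hy hy' => ?_⟩
      calc dist (y : X) y' ≤ dist (y : X) x + dist (y' : X) x := dist_triangle_right _ _ _
        _ < 1 / (n + 1) / 2 + 1 / (n + 1) / 2 := add_lt_add (hW y hy) (hW y' hy')
        _ = 1 / (n + 1) := add_halves _
    · have hxV : (x : X) ∈ V n := mem_iInter.1 (hCV.subset x.2) n
      obtain ⟨A, hA, hAc, hAV⟩ := exists_mem_nhds_isClosed_subset ((hVo n).mem_nhds hxV)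
      obtain ⟨W, hWo, hxW, hW⟩ := hpull x A hA
      refine ⟨W, hWo, hxW, (closure_minimal ?_ hAc).trans hAV⟩
      rintro _ ⟨y, hy, rfl⟩
      exact hW y hy
  · rintro s ⟨hs, hsP, hsR⟩
    have hne : (comap f (𝓝 s)).NeBot := comap_neBot_iff_frequently.2 (mem_closure_iff_frequently.1 hs)
    have hcauchy : Cauchy (map ((↑) : C → X) (comap f (𝓝 s))) := by
      refine Metric.cauchy_iff.2 ⟨hne.map _, fun ε hε => ?_⟩
      obtain ⟨n, hn⟩ := exists_nat_one_div_lt hε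
      obtain ⟨W, hWo, hsW, hW⟩ := mem_iInter.1 hsP n
      refine ⟨(↑) '' (f ⁻¹' W), image_mem_map (preimage_mem_comap (hWo.mem_nhds hsW)), ?_⟩
      rintro _ ⟨y, hy, rfl⟩ _ ⟨y', hy', rfl⟩
      exact (hW y y' hy hy').trans hn
    obtain ⟨x, hx⟩ := CompleteSpace.complete hcauchy
    have hxC : x ∈ C := by
      rw [hCV]
      refine mem_iInter.2 fun n => ?_
      obtain ⟨W, hWo, hsW, hW⟩ := mem_iInter.1 hsR n
      exact hW (mem_closure_of_tendsto (f := id) (b := map ((↑) : C → X) (comap f (𝓝 s))) hx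
        (image_mem_map (preimage_mem_comap (hWo.mem_nhds hsW))))
    refine ⟨⟨x, hxC⟩, ?_⟩
    have hx' : comap f (𝓝 s) ≤ 𝓝 (⟨x, hxC⟩ : C) := by
      rw [nhds_subtype_eq_comap]
      exact map_le_iff_le_comap.1 hx
    exact tendsto_nhds_unique ((hf.continuous.tendsto _).mono_left hx') tendsto_comap

theorem IsGδ.image_subtype_val {X : Type*} [TopologicalSpace X] {C : Set X} (hC : IsGδ C)
    {A : Set C} (hA : IsGδ A) : IsGδ ((↑) '' A : Set X) := by
  obtain ⟨V, hVo, rfl⟩ := isGδ_iff_eq_iInter_nat.1 hA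
  choose W hWo hWV using fun n => isOpen_induced_iff.1 (hVo n)
  have : ((↑) '' ⋂ n, V n : Set X) = C ∩ ⋂ n, W n := by
    rw [show ⋂ n, V n = ((↑) : C → X) ⁻¹' ⋂ n, W n by rw [preimage_iInter]; simp only [hWV],
      Subtype.image_preimage_coe]
  rw [this]
  exact hC.inter (IsGδ.iInter_of_isOpen hWo)

end Range

/-! ### Comparison of two codings -/

section Comparison

theorem isTopologicalBasis_truncate_fibers :
    TopologicalSpace.IsTopologicalBasis
      {A : Set (ℕ → ℕ) | ∃ (n : ℕ) (s : ℕ → ℕ), A = {t | truncate n t = truncate n s}} := by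
  refine TopologicalSpace.isTopologicalBasis_of_isOpen_of_nhds ?_ ?_
  · rintro _ ⟨n, s, rfl⟩
    simp only [truncate_eq_truncate_iff, ofPred_forall]
    refine (finite_le_nat n).isOpen_biInter fun i _ => ?_
    exact (isOpen_discrete ({s i} : Set ℕ)).preimage
      (continuous_apply (A := fun _ : ℕ => ℕ) i)
  · intro s V hs hV
    obtain ⟨_, ⟨s', n, rfl⟩, hs', hsub⟩ :=
      (PiNat.isTopologicalBasis_cylinders fun _ : ℕ => ℕ).exists_subset_of_mem_open hs hV
    refine ⟨_, ⟨n, s, rfl⟩, rfl, fun t ht => hsub fun i hi => ?_⟩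
    rw [truncate_eq_truncate_iff.1 ht i hi.le, hs' i hi]

variable {X : Type u} {Y : Type v} [TopologicalSpace X] [MeasurableSpace X] [BorelSpace X]
  [TopologicalSpace Y] [MeasurableSpace Y] [BorelSpace Y]
  {T : X ≃ₜ X} {S : Y ≃ₜ Y} {μ : Measure X} {ν : Measure Y} {I : ℕ → Set (ℕ → ℕ)} {c : ℕ → ℝ≥0∞}
  {C : Set X} {D : Set Y} {Φ : X → ℕ → ℕ} {Ψ : Y → ℕ → ℕ}

theorem IsCoding.map_apply (h : IsCoding T μ I c C Φ) {A : Set (ℕ → ℕ)} (hA : MeasurableSet A) :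
    (μ.comap ((↑) : C → X)).map (fun x : C => Φ x) A = μ (C ∩ Φ ⁻¹' A) := by
  rw [Measure.map_apply h.isEmbedding.continuous.measurable hA,
    (MeasurableEmbedding.subtype_coe h.isCore.isGδ.measurableSet).comap_apply]
  congr 1
  ext x
  simp [and_comm]

/-- The distribution of the codes is determined by the measures of the cylinders. -/
theorem IsCoding.map_eq (hX : IsCoding T μ I c C Φ) (hY : IsCoding S ν I c D Ψ) (hc : c 0 ≠ ⊤) :
    (μ.comap ((↑) : C → X)).map (fun x : C => Φ x) =
      (ν.comap ((↑) : D → Y)).map (fun y : D => Ψ y) := by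
  have hopen := fun n s => isTopologicalBasis_truncate_fibers.isOpen ⟨n, s, rfl⟩
  have hm : ∀ n s, MeasurableSet {t | truncate n t = truncate n s} := fun n s =>
    (hopen n s).measurableSet
  refine Measure.ext_of_generateFrom_of_iUnion _
    (fun i => {t | truncate 0 t = truncate 0 fun _ => i})
    ((BorelSpace.measurable_eq (α := ℕ → ℕ)).trans
      isTopologicalBasis_truncate_fibers.borel_eq_generateFrom) ?_ ?_ (fun i => ⟨0, _, rfl⟩) ?_ ?_
  · rintro _ ⟨n, s, rfl⟩ _ ⟨k, t, rfl⟩ ⟨r, hr1, hr2⟩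
    refine ⟨max n k, r, ?_⟩
    ext q
    simp only [mem_inter_iff, mem_ofPred_eq, truncate_eq_truncate_iff] at hr1 hr2 ⊢
    constructor
    · rintro ⟨h1, h2⟩ i hi
      rcases le_max_iff.1 hi with h | h
      · rw [h1 i h, hr1 i h]
      · rw [h2 i h, hr2 i h]
    · intro h
      exact ⟨fun i hi => (h i (hi.trans (le_max_left _ _))).trans (hr1 i hi),
        fun i hi => (h i (hi.trans (le_max_right _ _))).trans (hr2 i hi)⟩
  · refine eq_univ_of_forall fun t => mem_iUnion.2 ⟨t 0, ?_⟩
    refine truncate_eq_truncate_iff.2 fun i hi => ?_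
    rw [Nat.le_zero.1 hi]
  · intro i
    rw [hX.map_apply (hm _ _)]
    by_cases hw : truncate 0 (fun _ => i) ∈ I 0
    · exact (hX.measure_mem 0 _ hw).trans_ne hc
    · exact (hX.measure_notMem 0 _ hw).trans_ne ENNReal.zero_ne_top
  · rintro _ ⟨n, s, rfl⟩
    rw [hX.map_apply (hm _ _), hY.map_apply (hm _ _)]
    by_cases hw : truncate n s ∈ I n
    · exact (hX.measure_mem n _ hw).trans (hY.measure_mem n _ hw).symm
    · exact (hX.measure_notMem n _ hw).trans (hY.measure_notMem n _ hw).symm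

theorem IsCoding.isGδ_image [PolishSpace X] (h : IsCoding T μ I c C Φ) : IsGδ (Φ '' C) := by
  rw [image_eq_range]
  exact h.isEmbedding.isGδ_range h.isCore.isGδ

/-- The points whose code is also the code of a point of the other system form a core. -/
theorem IsCoding.isCore_inter_preimage [PolishSpace Y] (hX : IsCoding T μ I c C Φ)
    (hY : IsCoding S ν I c D Ψ) (hc : c 0 ≠ ⊤) : IsCore T μ (C ∩ Φ ⁻¹' (Ψ '' D)) where
  isGδ := by
    have := hX.isCore.isGδ.image_subtype_val (hY.isGδ_image.preimage hX.isEmbedding.continuous)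
    convert this using 1
    ext x
    simp [and_comm]
  preimage_eq := by
    have key : ∀ x ∈ C, ∀ k : ℤ, Φ x ∈ Ψ '' D → Φ ((T ^ k) x) ∈ Ψ '' D := by
      rintro x hx k ⟨y, hy, hyx⟩
      have h1 : Φ ((T ^ k) x) ∈ Φ '' zorbit T x := ⟨_, ⟨k, rfl⟩, rfl⟩
      rw [hX.image_zorbit x hx, ← hyx, ← hY.image_zorbit y hy] at h1
      obtain ⟨_, ⟨j, rfl⟩, hj⟩ := h1
      exact ⟨_, hY.isCore.zpow_mem j hy, hj⟩
    ext x
    constructor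
    · rintro ⟨h1, h2⟩
      refine ⟨(hX.isCore.zpow_mem_iff 1 x).1 h1, ?_⟩
      have := key _ h1 (-1) h2
      rwa [show T x = (T ^ (1 : ℤ)) x from rfl, zpow_neg_apply_zpow] at this
    · rintro ⟨h1, h2⟩
      exact ⟨hX.isCore.zpow_mem 1 h1, key x h1 1 h2⟩
  null := by
    have hm : MeasurableSet (Ψ '' D)ᶜ := hY.isGδ_image.measurableSet.compl
    have h0 : μ (C ∩ Φ ⁻¹' (Ψ '' D)ᶜ) = 0 := by
      rw [← hX.map_apply hm, hX.map_eq hY hc, hY.map_apply hm]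
      convert measure_empty (μ := ν)
      ext y
      simp only [mem_inter_iff, mem_preimage, mem_compl_iff, mem_empty_iff_false, iff_false, not_and,
        not_not]
      exact fun hy => mem_image_of_mem Ψ hy
    refine measure_mono_null ?_ (measure_union_null hX.isCore.null h0)
    intro x hx
    by_cases hxC : x ∈ C
    · exact Or.inr ⟨hxC, fun h => hx ⟨hxC, h⟩⟩
    · exact Or.inl hxC

/-- If the codes of the two systems are the same sequences, points with the same code correspond to
each other. -/
theorem IsCoding.almostContinuouslyOrbitEquivalent_of_image_eq [PolishSpace Y]
    (hX : IsCoding T μ I c C Φ) (hY : IsCoding S ν I c D Ψ) (hc : c 0 ≠ ⊤)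
    (him : Φ '' C = Ψ '' D) : AlmostContinuouslyOrbitEquivalent μ ν T S := by
  have hr : (range fun x : C => Φ x) = range fun y : D => Ψ y := by
    rw [← image_eq_range, him, image_eq_range]
  let φ : C ≃ₜ D := hX.isEmbedding.toHomeomorph.trans
    ((Homeomorph.setCongr hr).trans hY.isEmbedding.toHomeomorph.symm)
  have hφ : ∀ x : C, Ψ (φ x) = Φ x := fun x => congrArg Subtype.val
    (hY.isEmbedding.toHomeomorph.apply_symm_apply
      (Homeomorph.setCongr hr (hX.isEmbedding.toHomeomorph x)))
  have hinj : InjOn Ψ D := fun y hy y' hy' h =>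
    congrArg Subtype.val (hY.isEmbedding.injective (a₁ := ⟨y, hy⟩) (a₂ := ⟨y', hy'⟩) h)
  have hemb : MeasurableEmbedding fun y : D => Ψ y :=
    hY.isEmbedding.measurableEmbedding (by rw [← image_eq_range]; exact hY.isGδ_image.measurableSet)
  refine ⟨C, D, hX.isCore.isGδ, hY.isCore.isGδ, hX.isCore.preimage_eq, hY.isCore.preimage_eq,
    hX.isCore.null, hY.isCore.null, φ, ⟨φ.continuous.measurable, ?_⟩, fun x => ?_⟩
  · refine hemb.map_injective ?_
    rw [Measure.map_map hemb.measurable φ.continuous.measurable, ← hX.map_eq hY hc]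
    congr 1
    funext x
    exact hφ x
  · refine (hinj.image_eq_image_iff ?_ ?_).1 ?_
    · rintro _ ⟨z, -, rfl⟩
      exact (φ z).2
    · rintro _ ⟨k, rfl⟩
      exact hY.isCore.zpow_mem k (φ x).2
    · rw [hY.image_zorbit _ (φ x).2, hφ, ← hX.image_zorbit _ x.2, image_image]
      simp only [hφ]
      refine Subset.antisymm ?_ ?_
      · rintro _ ⟨z, hz, rfl⟩
        exact ⟨z, hz, rfl⟩
      · rintro _ ⟨_, ⟨k, rfl⟩, rfl⟩
        exact ⟨⟨_, hX.isCore.zpow_mem k x.2⟩, ⟨k, rfl⟩, rfl⟩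

theorem IsCoding.almostContinuouslyOrbitEquivalent [PolishSpace X] [PolishSpace Y]
    (hX : IsCoding T μ I c C Φ) (hY : IsCoding S ν I c D Ψ) (hc : c 0 ≠ ⊤) :
    AlmostContinuouslyOrbitEquivalent μ ν T S := by
  refine (hX.mono (hX.isCore_inter_preimage hY hc) inter_subset_left)
    |>.almostContinuouslyOrbitEquivalent_of_image_eq
    (hY.mono (hY.isCore_inter_preimage hX hc) inter_subset_left) hc ?_
  refine Subset.antisymm ?_ ?_
  · rintro _ ⟨x, ⟨hx, y, hy, hyx⟩, rfl⟩
    exact ⟨y, ⟨hy, x, hx, hyx.symm⟩, hyx⟩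
  · rintro _ ⟨y, ⟨hy, x, hx, hyx⟩, rfl⟩
    exact ⟨x, ⟨hx, y, hy, hyx.symm⟩, hyx⟩

end Comparison

/-! ### Parallel construction for two systems -/

section Construction

variable {X : Type u} {Y : Type v} [TopologicalSpace X] [MeasurableSpace X] [BorelSpace X]
  [TopologicalSpace Y] [MeasurableSpace Y] [BorelSpace Y]
  {T : X ≃ₜ X} {S : Y ≃ₜ Y} {μ : Measure X} {ν : Measure Y}

theorem Ergodic.ae_exists_nhds_measure_ne_top (hT : Ergodic T μ)
    (hX : ∃ U : Set X, IsOpen U ∧ μ U ≠ 0 ∧ μ U ≠ ⊤) : ∀ᵐ x ∂μ, ∃ V ∈ 𝓝 x, μ V ≠ ⊤ := by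
  obtain ⟨U, hUo, hU0, hUt⟩ := hX
  filter_upwards [hT.ae_exists_zpow_mem hUo.measurableSet.nullMeasurableSet hU0] with x ⟨k, hk⟩
  refine ⟨(T ^ k : X ≃ₜ X) ⁻¹' U, (hUo.preimage (T ^ k : X ≃ₜ X).continuous).mem_nhds hk, ?_⟩
  rwa [measure_zpow_preimage hT.toMeasurePreserving]

/-- Stages for the two systems can be chosen simultaneously, with the same label sets and the same
measures, because the base of a stage can be cut into any sufficiently large number of pieces. -/
theorem exists_parallel_stages {g : X → ℝ} {h : Y → ℝ} {U : ℕ → Set X} {V : ℕ → Set Y}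
    (hg : IsCoordinate μ g) (hh : IsCoordinate ν h) (hT : Ergodic T μ) (hS : Ergodic S ν)
    (hμ : μ univ = ⊤) (hν : ν univ = ⊤)
    (hU : ∀ j, μ (frontier (U j)) = 0) (hV : ∀ j, ν (frontier (V j)) = 0) :
    ∃ (c : ℕ → ℝ≥0∞) (m : ℕ → ℕ) (s : ℕ → Stage X) (t : ℕ → Stage Y), c 0 ≠ ⊤ ∧
      (∀ n, (s n).labels = (t n).labels) ∧
      (∀ n, IsStage T μ n (c n) (s n)) ∧ (∀ n, IsStage S ν n (c n) (t n)) ∧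
      (∀ n, Refines T μ U n (m n) (s n) (s (n + 1))) ∧
      ∀ n, Refines S ν V n (m n) (t n) (t (n + 1)) := by
  let P : ℕ → ℝ≥0∞ × Stage X × Stage Y → Prop := fun n p => p.1 ≠ 0 ∧ p.1 ≠ ⊤ ∧
    p.2.1.labels = p.2.2.labels ∧ IsStage T μ n p.1 p.2.1 ∧ IsStage S ν n p.1 p.2.2
  have h0 : ∃ p, P 0 p := by
    obtain ⟨s, hs, hsl⟩ := hg.exists_isStage_zero hT hμ
    obtain ⟨t, ht, htl⟩ := hh.exists_isStage_zero hS hν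
    exact ⟨(1, s, t), one_ne_zero, ENNReal.one_ne_top, hsl.trans htl.symm, hs, ht⟩
  have hstep : ∀ n (p : {p // P n p}), ∃ (q : {q // P (n + 1) q}) (m : ℕ),
      Refines T μ U n m p.1.2.1 q.1.2.1 ∧ Refines S ν V n m p.1.2.2 q.1.2.2 := by
    rintro n ⟨⟨c, s, t⟩, hc0, hct, hl, hs, ht⟩
    obtain ⟨k, hk0, hk⟩ := hs.exists_refines hg hT hc0 hct hU
    obtain ⟨k', -, hk'⟩ := ht.exists_refines hh hS hc0 hct hV
    obtain ⟨s', hs', hss'⟩ := hk (max k k') (le_max_left _ _)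
    obtain ⟨t', ht', htt'⟩ := hk' (max k k') (le_max_right _ _)
    have hm : max k k' ≠ 0 := fun h => hk0 (by omega)
    refine ⟨⟨(c / (max k k' : ℕ), s', t'), ?_, ?_, ?_, hs', ht'⟩, max k k', hss', htt'⟩
    · exact ENNReal.div_ne_zero.2 ⟨hc0, ENNReal.natCast_ne_top _⟩
    · exact ENNReal.div_ne_top hct (Nat.cast_ne_zero.2 hm)
    · change s'.labels = t'.labels
      rw [hss'.labels_eq, htt'.labels_eq, show s.labels = t.labels from hl]
  choose next m hnext hnext' using hstep
  obtain ⟨p₀, hp₀⟩ := h0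
  let p : ∀ n, {p // P n p} := fun n => Nat.rec ⟨p₀, hp₀⟩ (fun n p => next n p) n
  exact ⟨fun n => (p n).1.1, fun n => m n (p n), fun n => (p n).1.2.1, fun n => (p n).1.2.2,
    (p 0).2.2.1, fun n => (p n).2.2.2.1, fun n => (p n).2.2.2.2.1, fun n => (p n).2.2.2.2.2,
    fun n => hnext n (p n), fun n => hnext' n (p n)⟩

end Construction

theorem theorem3 {X : Type u} {Y : Type v}
    [TopologicalSpace X] [PolishSpace X] [MeasurableSpace X] [BorelSpace X]
    [TopologicalSpace Y] [PolishSpace Y] [MeasurableSpace Y] [BorelSpace Y]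
    (μ : Measure X) (ν : Measure Y)
    [SigmaFinite μ] [NullSingletonClass μ] [SigmaFinite ν] [NullSingletonClass ν]
    (hμ : μ Set.univ = ⊤) (hν : ν Set.univ = ⊤)
    (hX : ∃ U : Set X, IsOpen U ∧ μ U ≠ 0 ∧ μ U ≠ ⊤)
    (hY : ∃ V : Set Y, IsOpen V ∧ ν V ≠ 0 ∧ ν V ≠ ⊤)
    (T : X ≃ₜ X) (S : Y ≃ₜ Y)
    (hT : Ergodic T μ) (hS : Ergodic S ν) :
    AlmostContinuouslyOrbitEquivalent μ ν T S := by
  have : Nonempty X := (nonempty_of_measure_ne_zero (hμ.trans_ne ENNReal.top_ne_zero)).to_type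
  have : Nonempty Y := (nonempty_of_measure_ne_zero (hν.trans_ne ENNReal.top_ne_zero)).to_type
  obtain ⟨U, hUo, hU0, hU⟩ := exists_null_frontier_basis μ
  obtain ⟨V, hVo, hV0, hV⟩ := exists_null_frontier_basis ν
  obtain ⟨g, hg⟩ := exists_isCoordinate μ hU0 hU (hT.ae_exists_nhds_measure_ne_top hX)
  obtain ⟨h, hh⟩ := exists_isCoordinate ν hV0 hV (hS.ae_exists_nhds_measure_ne_top hY)
  obtain ⟨c, m, s, t, hc, hl, hs, ht, hss, htt⟩ :=
    exists_parallel_stages hg hh hT hS hμ hν hU0 hV0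
  obtain ⟨C, hC⟩ := exists_isCoding hT.toMeasurePreserving hU hs hss
  obtain ⟨D, hD⟩ := exists_isCoding hS.toMeasurePreserving hV ht htt
  rw [funext hl] at hC
  exact hC.almostContinuouslyOrbitEquivalent hD hc
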